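/- **Theorem 1 (Intertwining of birth-and-death processes).** Let $b_1,\ldots,b_N>0$, $d_1,\ldots,d_{N-1}>0$ and $d_N=0$, and let $G$ be the generator of the continuous-time birth-and-death process on $\{0,\ldots,N\}$ that jumps from $x-1$ to $x$ with birth rate $b_x$ and from $x$ to $x-1$ with death rate $d_x$, i.e. $$Gf(x)=b_{x+1}\big(f(x+1)-f(x)\big)+d_x\big(f(x-1)-f(x)\big)\qquad(0\le x\le N),$$ with the convention that $d_0=b_{N+1}=0$. Then $G$ has exactly $N+1$ distinct eigenvalues $0=-\lambda_0>-\lambda_1>\cdots>-\lambda_N$, all real. Let $G^-$ and $G^+$ be the generators of the pure birth processes on $\{0,\ldots,N\}$ with birth rates $b^-_1:=\lambda_1,\ldots,b^-_N:=\lambda_N$ and $b^+_1:=\lambda_N,\ldots,b^+_N:=\lambda_1$, respectively. Then there exist probability kernels $K^-$ and $K^+$ on $\{0,\ldots,N\}$ with $$K^\pm(x,\{0,\ldots,x\})=1\quad(0\le x\le N),\qquad K^\pm(N,N)=1,$$ and $$K^+G=G^+K^+,\qquad GK^-=K^-G^-,$$ such that moreover there exist, on a common probability space, Markov processes $X^-,X,X^+$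 with right-continuous paths having left limits, all started in $0$ and with generators $G^-,G,G^+$ respectively, satisfying, almost surely, $$\mathbb P\big[X_t=y\,\big|\,(X^+_s)_{0\le s\le t}\big]=K^+(X^+_t,y),\qquad \mathbb P\big[X^-_t=y\,\big|\,(X^+_s,X_s)_{0\le s\le t}\big]=K^-(X_t,y)$$ for all $t\ge0$ and $0\le y\le N$. Every such coupling satisfies, almost surely, $X^-_t\le X_t\le X^+_t$ for all $t\ge0$ and $\tau^-_N=\tau_N=\tau^+_N$, where $\tau_N:=\inf\{t\ge0:X_t=N\}$ and $\tau^\pm_N$ are defined in the same way for $X^\pm$. -/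

import Mathlib

open MeasureTheory Filter Topology
open scoped ProbabilityTheory NNReal Matrix

/-- The generator, as a matrix indexed by the states `{0, …, N}`, of the birth-and-death process
with birth rates `b 1, …, b N` (`b x` is the rate of the jump from `x - 1` to `x`) and death rates
`d 1, …, d N` (`d x` is the rate of the jump from `x` to `x - 1`). The values `b 0`, `b (N + 1)`,
`d 0`, … are never used. -/
def bdGenerator (N : ℕ) (b d : ℕ → ℝ) : Matrix (Fin (N + 1)) (Fin (N + 1)) ℝ :=
  Matrix.of fun x y =>
    if (y : ℕ) = x + 1 then b (x + 1)
    else if (y : ℕ) + 1 = x then d x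
    else if y = x then
      -((if (x : ℕ) < N then b (x + 1) else 0) + (if 0 < (x : ℕ) then d x else 0))
    else 0

/-- The σ-algebra generated by `(X s)` for `0 ≤ s ≤ t`. -/
abbrev pastSigma {Ω S : Type*} [MeasurableSpace S] (X : ℝ≥0 → Ω → S) (t : ℝ≥0) :
    MeasurableSpace Ω :=
  ⨆ s ∈ Set.Iic t, MeasurableSpace.comap (X s) inferInstance

/-- Under `P`, the process `X` is a continuous-time Markov process (with respect to the filtration
it generates) with finite state space `S`, generator `G` and initial state `x₀`. As usual, its
paths are almost surely right-continuous with left limits for the discrete topology on `S`. -/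
structure IsMarkovProcess {Ω S : Type*} [MeasurableSpace Ω] [Fintype S] [DecidableEq S]
    [MeasurableSpace S] (P : Measure Ω) (G : Matrix S S ℝ) (x₀ : S)
    (X : ℝ≥0 → Ω → S) : Prop where
  measurable : ∀ t, Measurable (X t)
  start : ∀ᵐ ω ∂P, X 0 ω = x₀
  right_continuous : ∀ᵐ ω ∂P, ∀ t, ∀ᶠ s in 𝓝[≥] t, X s ω = X t ω
  left_limits : ∀ᵐ ω ∂P, ∀ t, ∃ l, ∀ᶠ s in 𝓝[<] t, X s ω = l
  markov : ∀ (s t : ℝ≥0) (y : S),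
    P⟦{ω | X (s + t) ω = y} | pastSigma X s⟧
      =ᵐ[P] fun ω => NormedSpace.exp ((t : ℝ) • G) (X s ω) y

/-- Lower-triangular probability kernels `K` on `{0, …, N}` with `K(N, N) = 1`. -/
structure IsTriangularKernel {N : ℕ} (K : Matrix (Fin (N + 1)) (Fin (N + 1)) ℝ) : Prop where
  stochastic : K ∈ Matrix.rowStochastic ℝ (Fin (N + 1))
  triangular : ∀ x, ∑ y ∈ Finset.Iic x, K x y = 1
  last : K (Fin.last N) (Fin.last N) = 1

/-- The processes `Xm`, `X`, `Xp` (standing for `X⁻`, `X`, `X⁺`), defined on a common probability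
space, are Markov processes on `{0, …, N}` started in `0` with generators `Gm`, `G`, `Gp`, and
the conditional laws of `X` given `Xp` and of `Xm` given `(Xp, X)` are given by the kernels `Kp`
and `Km`. -/
structure IsIntertwinedCoupling {Ω : Type*} [MeasurableSpace Ω] {N : ℕ} (P : Measure Ω)
    (Gm G Gp Km Kp : Matrix (Fin (N + 1)) (Fin (N + 1)) ℝ)
    (Xm X Xp : ℝ≥0 → Ω → Fin (N + 1)) : Prop where
  markov_minus : IsMarkovProcess P Gm 0 Xm
  markov : IsMarkovProcess P G 0 X
  markov_plus : IsMarkovProcess P Gp 0 Xp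
  cond_plus : ∀ (t : ℝ≥0) (y : Fin (N + 1)),
    P⟦{ω | X t ω = y} | pastSigma Xp t⟧ =ᵐ[P] fun ω => Kp (Xp t ω) y
  cond_minus : ∀ (t : ℝ≥0) (y : Fin (N + 1)),
    P⟦{ω | Xm t ω = y} | pastSigma (fun s ω => (Xp s ω, X s ω)) t⟧
      =ᵐ[P] fun ω => Km (X t ω) y

/-- The first passage time `inf {t ≥ 0 : X t = N}`, with value `⊤` if `N` is never reached. -/
noncomputable def passageTime {Ω : Type*} {N : ℕ} (X : ℝ≥0 → Ω → Fin (N + 1)) :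
    Ω → WithTop ℝ≥0 :=
  hittingAfter X {Fin.last N} 0

/-! The proof has an algebraic part, which produces the eigenvalues and the two kernels, and a
probabilistic part, which turns the two intertwining relations into a coupling of processes.

*Kernels.* Write `-λ_N < ⋯ < -λ_1` for the nonzero eigenvalues of `G`. The relation
`K⁺ G = G⁺ K⁺` forces the rows of `K⁺` to be proportional to `δ₀ (G + λ_N) (G + λ_{N-1}) ⋯`, and
`G K⁻ = K⁻ G⁻` forces the columns of `K⁻` to be proportional to `⋯ (G + λ_{N-1}) (G + λ_N) G δ_N`,
so everything rests on the nonnegativity of these spectral products. This is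
`exists_isSpectralProduct`: for a tridiagonal matrix with positive off-diagonal entries, the
products that take the most negative eigenvalues first map `δ₀` to nonnegative vectors. The proof
is by induction on the size. The largest eigenvalue has a positive left eigenvector
(`exists_pos_jacobiLeft_eq`, from the Sturm property of the characteristic polynomials of the
blocks), and a Darboux transformation with this eigenvector gives an intertwining with a smaller
tridiagonal matrix that has the remaining eigenvalues. The same induction shows that the
eigenvalues are real and simple, so they never have to be postulated: as `K⁺` and `K⁻` are
triangular with positive diagonals, they are invertible, and the spectrum of `G` is the diagonal of `G⁺` or `G⁻`
(`exists_kernel_plus`, `exists_kernel_minus`).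

*Coupling.* After uniformization, `Q = 1 + r⁻¹ G` for a large common rate `r`, the generators become
transition matrices with the same intertwinings. The matrix `coupledMatrix` of Diaconis and Fill
couples `Q⁺` with `Q`, and then this coupling with `Q⁻`. The resulting chain on triples is run at
the times of a Poisson process (`isMarkovProcess_jumpProcess`). By construction `X⁻` is autonomous,
and so is `X` within the pair `(X⁺, X)`; such processes are Markov by
`IsMarkovProcess.map_of_autonomous`. The pair `(X⁺, X)`, the process `X⁺` and the conditional laws
are treated by the criterion of Rogers and Pitman: if `Λ L = G Λ` for a kernel `Λ` into the fibres
of a map `π`, then `π ∘ Z` is Markov with generator `G`, and `Λ` is the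
conditional law of `Z t` given the past of `π ∘ Z` (`IsMarkovProcess.map_of_intertwining`,
`IsMarkovProcess.condProb_of_intertwining`).

*Paths.* In any coupling, almost surely `K⁺(X⁺ t, X t)` and `K⁻(X t, X⁻ t)` are nonzero at each
fixed time, hence at all times of a countable dense set, hence at all times by right-continuity
(`IsIntertwinedCoupling.ae_kernel_ne_zero`). As the kernels are lower triangular with
`K(N, N) = 1`, this gives both the ordering of the three processes and their simultaneous presence
in `N`. -/

/-! ### Positivity of spectral products of Jacobi matrices -/

/-- The row vector `v T`, where `T` is the tridiagonal matrix on `ℕ` with entries `T x (x+1) = u x`,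
`T x x = a x` and `T x (x-1) = d x` for `x ≥ 1`. -/
def jacobiLeft (u a d v : ℕ → ℝ) : ℕ → ℝ
  | 0 => v 0 * a 0 + v 1 * d 1
  | y + 1 => v y * u y + v (y + 1) * a (y + 1) + v (y + 2) * d (y + 2)

/-- The solution `q`, normalised by `q 0 = 1`, of the three-term recurrence that says that `q` is a
formal left eigenvector with eigenvalue `μ` of the tridiagonal matrix of `jacobiLeft`. Up to
scaling, `q (n+1)` is the characteristic polynomial of the block `{0, …, n}`. -/
noncomputable def jacobiPoly (u a d : ℕ → ℝ) (μ : ℝ) : ℕ → ℝ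
  | 0 => 1
  | 1 => (μ - a 0) / d 1
  | k + 2 => ((μ - a (k + 1)) * jacobiPoly u a d μ (k + 1) - u k * jacobiPoly u a d μ k) / d (k + 2)

lemma continuous_jacobiPoly (u a d : ℕ → ℝ) (k : ℕ) :
    Continuous fun μ => jacobiPoly u a d μ k := by
  induction k using Nat.twoStepInduction with
  | zero => simpa [jacobiPoly] using continuous_const
  | one => simp only [jacobiPoly]; fun_prop
  | more k h1 h2 => simp only [jacobiPoly]; fun_prop

lemma jacobiPoly_pos_of_large (u a d : ℕ → ℝ) (hu : ∀ k, 0 < u k) (hd : ∀ k, 0 < d k) (n : ℕ) :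
    ∃ M, ∀ μ ≥ M, ∀ k ≤ n, 0 < jacobiPoly u a d μ k ∧
      jacobiPoly u a d μ k ≤ jacobiPoly u a d μ (k + 1) := by
  induction n with
  | zero =>
    refine ⟨a 0 + d 1, fun μ hμ k hk => ?_⟩
    obtain rfl : k = 0 := by omega
    simp only [jacobiPoly]
    exact ⟨one_pos, by rw [le_div_iff₀ (hd 1)]; linarith⟩
  | succ n ih =>
    obtain ⟨M, hM⟩ := ih
    refine ⟨max M (a (n + 1) + u n + d (n + 2)), fun μ hμ k hk => ?_⟩
    have h1 := hM μ (le_trans (le_max_left _ _) hμ)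
    rcases Nat.lt_or_ge k (n + 1) with h | h
    · exact h1 k (by omega)
    · obtain rfl : k = n + 1 := by omega
      have h2 := h1 n le_rfl
      have h3 : 0 < jacobiPoly u a d μ (n + 1) := h2.1.trans_le h2.2
      refine ⟨h3, ?_⟩
      have h4 := le_trans (le_max_right _ _) hμ
      rw [show n + 1 + 1 = n + 2 from rfl, jacobiPoly, le_div_iff₀ (hd _)]
      nlinarith [mul_le_mul_of_nonneg_left h2.2 (hu n).le,
        mul_le_mul_of_nonneg_right h4 h3.le]

/-- At the largest zero of `jacobiPoly · (n+1)`, all earlier terms of the recurrence are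
positive. -/
lemma exists_jacobiPoly_eq_zero (u a d : ℕ → ℝ) (hu : ∀ k, 0 < u k) (hd : ∀ k, 0 < d k) (n : ℕ) :
    ∃ μ, (∀ k ≤ n, 0 < jacobiPoly u a d μ k) ∧ jacobiPoly u a d μ (n + 1) = 0 := by
  set E : Set ℝ := {m | ∀ μ ≥ m, ∀ k ≤ n + 1, 0 < jacobiPoly u a d μ k} with hE
  obtain ⟨M, hM⟩ := jacobiPoly_pos_of_large u a d hu hd (n + 1)
  have hne : E.Nonempty := ⟨M, fun μ hμ k hk => (hM μ hμ k hk).1⟩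
  have hbdd : BddBelow E := by
    refine ⟨a 0, fun m hm => ?_⟩
    have h := hm m le_rfl 1 (by omega)
    simp only [jacobiPoly] at h
    have := (div_pos_iff_of_pos_right (hd 1)).1 h
    linarith
  set μ := sInf E with hμ
  have hgt : ∀ ν > μ, ∀ k ≤ n + 1, 0 < jacobiPoly u a d ν k := by
    intro ν hν
    obtain ⟨m, hm, hlt⟩ := exists_lt_of_csInf_lt hne hν
    exact hm ν hlt.le
  have hnonneg : ∀ k ≤ n + 1, 0 ≤ jacobiPoly u a d μ k := by
    intro k hk
    refine ge_of_tendsto (((continuous_jacobiPoly u a d k).tendsto μ).mono_left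
      (nhdsWithin_le_nhds (s := Set.Ioi μ))) ?_
    filter_upwards [self_mem_nhdsWithin] with ν hν using (hgt ν hν k hk).le
  -- If one of the middle terms vanished, the recurrence would make its successor negative.
  have hpos : ∀ k ≤ n, 0 < jacobiPoly u a d μ k := by
    intro k
    induction k with
    | zero => intro _; simp [jacobiPoly]
    | succ k ih =>
      intro hk
      refine lt_of_le_of_ne (hnonneg _ (by omega)) fun h0 => ?_
      have h1 := hnonneg (k + 2) (by omega)
      have h2 := ih (by omega)
      rw [jacobiPoly, ← h0] at h1
      have := mul_pos (hu k) h2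
      exact absurd h1 (not_le.2 (div_neg_of_neg_of_pos (by linarith) (hd (k + 2))))
  refine ⟨μ, hpos, ?_⟩
  by_contra hne0
  have hpos' : ∀ k ≤ n + 1, 0 < jacobiPoly u a d μ k := by
    intro k hk
    rcases Nat.lt_or_ge k (n + 1) with h | h
    · exact hpos k (by omega)
    · obtain rfl : k = n + 1 := by omega
      exact lt_of_le_of_ne (hnonneg _ le_rfl) (Ne.symm hne0)
  have hev : ∀ᶠ ν in 𝓝 μ, ∀ k ∈ Finset.range (n + 2), 0 < jacobiPoly u a d ν k := by
    rw [Filter.eventually_all_finset]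
    intro k hk
    exact (continuous_jacobiPoly u a d k).continuousAt.eventually
      (lt_mem_nhds (hpos' k (by simpa [Nat.lt_succ_iff] using hk)))
  obtain ⟨ε, hε, hball⟩ := Metric.eventually_nhds_iff.1 hev
  have hmem : μ - ε / 2 ∈ E := by
    intro ν hν k hk
    rcases lt_or_ge μ ν with h | h
    · exact hgt ν h k hk
    · refine hball ?_ k (by simpa [Nat.lt_succ_iff] using hk)
      rw [Real.dist_eq, abs_lt]
      constructor <;> linarith
  have := csInf_le hbdd hmem
  linarith

/-- Perron's theorem for Jacobi matrices: the block `{0, …, n}` of a tridiagonal matrix with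
positive off-diagonal entries has a positive left eigenvector. -/
lemma exists_pos_jacobiLeft_eq (u a d : ℕ → ℝ) (n : ℕ) (hu : ∀ x < n, 0 < u x)
    (hd : ∀ x, 1 ≤ x → x ≤ n → 0 < d x) :
    ∃ (μ : ℝ) (p : ℕ → ℝ), (∀ x ≤ n, 0 < p x) ∧ (∀ x, n < x → p x = 0) ∧
      ∀ y ≤ n, jacobiLeft u a d p y = μ * p y := by
  set u' : ℕ → ℝ := fun x => if x < n then u x else 1 with hu'
  set d' : ℕ → ℝ := fun x => if 1 ≤ x ∧ x ≤ n then d x else 1 with hd'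
  have hup : ∀ k, 0 < u' k := fun k => by
    simp only [hu']; split_ifs with h
    exacts [hu k h, one_pos]
  have hdp : ∀ k, 0 < d' k := fun k => by
    simp only [hd']; split_ifs with h
    exacts [hd k h.1 h.2, one_pos]
  obtain ⟨μ, hpos, hzero⟩ := exists_jacobiPoly_eq_zero u' a d' hup hdp n
  have hlast : ∀ y ≤ n, (if y + 1 ≤ n then jacobiPoly u' a d' μ (y + 1) else 0) * d (y + 1)
      = jacobiPoly u' a d' μ (y + 1) * d' (y + 1) := by
    intro y hy
    by_cases h : y + 1 ≤ n
    · simp [hd', h]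
    · obtain rfl : y = n := by omega
      simp [hzero]
  refine ⟨μ, fun x => if x ≤ n then jacobiPoly u' a d' μ x else 0, fun x hx => ?_, fun x hx => ?_,
    fun y hy => ?_⟩
  · simpa [hx] using hpos x hx
  · simp [not_le.2 hx]
  · match y with
    | 0 =>
      have := hlast 0 hy
      simp only [jacobiLeft, zero_add, Nat.zero_le, if_true] at this ⊢
      rw [this]
      have := (hdp 1).ne'
      simp only [jacobiPoly]
      field_simp
      ring
    | y + 1 =>
      have := hlast (y + 1) hy
      have hy' : y < n := hy
      simp only [jacobiLeft, hy, hy'.le, if_true] at this ⊢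
      rw [show y + 1 + 1 = y + 2 from rfl] at this
      rw [this, jacobiPoly]
      have h1 := (hdp (y + 2)).ne'
      have h2 : u' y = u y := by simp [hu', hy']
      rw [h2]
      field_simp
      ring

/-- The vectors `v i = δ₀ (T - m 0) ⋯ (T - m (i-1))`, `i ≤ n`, for the tridiagonal matrix `T` of
`jacobiLeft`, are nonnegative, `v i` lives on `{0, …, i}`, and `v n` is carried by the point `n`.
Since `v n` vanishes on `{0, …, n-1}`, the numbers `m 0 < ⋯ < m (n-1)` are the eigenvalues of the
block `{0, …, n-1}` of `T`. -/
structure IsSpectralProduct (n : ℕ) (u a d m : ℕ → ℝ) (v : ℕ → ℕ → ℝ) : Prop where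
  zero : ∀ y, v 0 y = if y = 0 then 1 else 0
  succ : ∀ i < n, ∀ y, v (i + 1) y = jacobiLeft u a d (v i) y - m i * v i y
  nonneg : ∀ i ≤ n, ∀ y, 0 ≤ v i y
  supp : ∀ i ≤ n, ∀ y, i < y → v i y = 0
  diag : ∀ i ≤ n, 0 < v i i
  last : ∀ y < n, v n y = 0
  lt : ∀ i, i + 1 < n → m i < m (i + 1)

/-- The tails of `w T'` when the diagonal of `T'` is `μ - u' - d'`: the sums telescope. -/
lemma sum_jacobiLeft_tail (n : ℕ) (u' d' : ℕ → ℝ) (μ : ℝ) (w : ℕ → ℝ) (hw : ∀ x, n ≤ x → w x = 0)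
    (y : ℕ) (hy : y ≤ n) :
    ∑ x ∈ Finset.Ico y (n + 1), jacobiLeft u' (fun x => μ - u' x - d' x) d' w x =
      (if y = 0 then 0 else w (y - 1) * u' (y - 1)) - w y * d' y +
        μ * ∑ x ∈ Finset.Ico y (n + 1), w x := by
  have key : ∀ y ≤ n + 1,
      ∑ x ∈ Finset.Ico y (n + 1), jacobiLeft u' (fun x => μ - u' x - d' x) d' w x =
      (if y = 0 then 0 else w (y - 1) * u' (y - 1)) - w y * d' y +
        μ * ∑ x ∈ Finset.Ico y (n + 1), w x := by
    intro y hy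
    induction hy using Nat.decreasingInduction with
    | self => simp [hw]
    | of_succ y hy ih =>
      rw [Finset.sum_eq_sum_Ico_succ_bot hy, Finset.sum_eq_sum_Ico_succ_bot hy, ih]
      cases y with
      | zero => simp [jacobiLeft]; ring
      | succ y => simp [jacobiLeft]; ring
  exact key y (by omega)

/-- The spectral products of a Jacobi matrix, with the most negative eigenvalues taken first, map
`δ₀` to nonnegative vectors (a case of the theorem of Micchelli and Willoughby). The induction
removes the largest eigenvalue `μ`, that of the positive left eigenvector `p`, by a Darboux
transformation: if `K x y = p y / p 0` for `y ≤ x` and `K x y = 0` otherwise, then `K T = T' K`,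
where `T'` is again a Jacobi matrix, whose block of size `n` carries the remaining eigenvalues. -/
theorem exists_isSpectralProduct (n : ℕ) (u a d : ℕ → ℝ) (hu : ∀ x < n, 0 < u x)
    (hd : ∀ x, 1 ≤ x → x < n → 0 < d x) :
    ∃ m v, IsSpectralProduct n u a d m v := by
  induction n generalizing u a d with
  | zero =>
    exact ⟨0, fun _ y => if y = 0 then 1 else 0, fun _ => rfl, by simp,
      fun i _ y => by positivity, fun i hi y hy => by simp; omega, fun i hi => by
        obtain rfl : i = 0 := by omega
        simp, by simp, by simp⟩
  | succ n ih =>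
    obtain ⟨μ, p, hp, hp0, hpe⟩ := exists_pos_jacobiLeft_eq u a d n (fun x hx => hu x (by omega))
      (fun x h1 h2 => hd x h1 (by omega))
    set u' : ℕ → ℝ := fun x => p x * u x / p (x + 1) with hu'
    set d' : ℕ → ℝ := fun x => p (x + 1) * d (x + 1) / p x with hd'
    obtain ⟨m, w, hw⟩ := ih u' (fun x => μ - u' x - d' x) d'
      (fun x hx => div_pos (mul_pos (hp _ (by omega)) (hu _ (by omega))) (hp _ (by omega)))
      (fun x _ hx => div_pos (mul_pos (hp _ (by omega)) (hd _ (by omega) (by omega)))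
        (hp _ (by omega)))
    set S : ℕ → ℕ → ℝ := fun i y => ∑ x ∈ Finset.Ico y (n + 1), w i x with hS
    set V : ℕ → ℕ → ℝ := fun i y => p y / p 0 * S i y with hV
    have hp00 : 0 < p 0 := hp 0 (by omega)
    have hSnn : ∀ i ≤ n, ∀ y, 0 ≤ S i y := fun i hi y =>
      Finset.sum_nonneg fun x _ => hw.nonneg i hi x
    have hpnn : ∀ y, 0 ≤ p y := fun y => by
      rcases le_or_gt y n with h | h
      exacts [(hp y h).le, (hp0 y h).ge]
    have hSstep : ∀ i, ∀ y ≤ n, S i y = w i y + S i (y + 1) := fun i y hy =>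
      Finset.sum_eq_sum_Ico_succ_bot (by omega) _
    have hStail : ∀ i ≤ n, ∀ y, i < y → S i y = 0 := fun i hi y hy =>
      Finset.sum_eq_zero fun x hx => hw.supp i hi x (by rw [Finset.mem_Ico] at hx; omega)
    have hSdiag : ∀ i ≤ n, S i i = w i i := fun i hi => by
      rw [hSstep i i hi, hStail i hi (i + 1) (by omega), add_zero]
    have hSsucc : ∀ i < n, ∀ y ≤ n, S (i + 1) y =
        (if y = 0 then 0 else w i (y - 1) * u' (y - 1)) - w i y * d' y + (μ - m i) * S i y := by
      intro i hi y hy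
      have := sum_jacobiLeft_tail n u' d' μ (w i) (fun x hx => hw.supp i hi.le x (by omega)) y hy
      simp only [hS] at this ⊢
      rw [Finset.sum_congr rfl fun x _ => hw.succ i hi x, Finset.sum_sub_distrib, this,
        ← Finset.mul_sum]
      ring
    have hVsucc : ∀ i < n, ∀ y, V (i + 1) y = jacobiLeft u a d (V i) y - m i * V i y := by
      intro i hi y
      rcases le_or_gt y n with hy | hy
      · have hpy := (hp y hy).ne'
        have e1 := hpe y hy
        have e2 := hSstep i y hy
        simp only [hV]
        rw [hSsucc i hi y hy]
        cases y with
        | zero =>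
          simp only [jacobiLeft, if_true, hd', zero_add] at e1 e2 ⊢
          rw [e2]
          field_simp
          linear_combination (-(w i 0 + S i 1)) * e1
        | succ y =>
          have e3 := hSstep i y (by omega)
          simp only [jacobiLeft, hu', hd', Nat.succ_ne_zero, if_false, Nat.add_sub_cancel,
            show y + 1 + 1 = y + 2 from rfl] at e1 e2 ⊢
          rw [e3, e2]
          field_simp
          linear_combination (-(w i (y + 1) + S i (y + 2))) * e1
      · have z1 : ∀ x, n < x → V i x = 0 := fun x hx => by simp [hV, hp0 x hx]
        have z2 : V (i + 1) y = 0 := by simp [hV, hp0 y hy]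
        have z3 : V i n = 0 := by simp [hV, hStail i hi.le n hi]
        obtain ⟨y, rfl⟩ : ∃ z, y = z + 1 := ⟨y - 1, by omega⟩
        have z4 : V i y = 0 := by
          rcases Nat.lt_or_ge n y with h | h
          · exact z1 y h
          · obtain rfl : y = n := by omega
            exact z3
        rw [z2, jacobiLeft, z1 (y + 1) hy, z1 (y + 2) (by omega), z4]
        ring
    have hVn : ∀ y, V n y = w n n / p 0 * p y := by
      intro y
      rcases le_or_gt y n with hy | hy
      · have : S n y = w n n := by
          simp only [hS]
          rw [Finset.sum_eq_single_of_mem n (by simp [hy])]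
          intro x hx hne
          rw [Finset.mem_Ico] at hx
          exact hw.last x (by omega)
        simp only [hV, this]; ring
      · simp [hV, hp0 y hy]
    have hcpos : 0 < w n n / p 0 := div_pos (hw.diag n le_rfl) hp00
    have hnew : ∀ y, jacobiLeft u a d (V n) y - μ * V n y =
        if y = n + 1 then w n n / p 0 * (p n * u n) else 0 := by
      intro y
      have hlin : jacobiLeft u a d (V n) y = w n n / p 0 * jacobiLeft u a d p y := by
        cases y <;> simp only [jacobiLeft, hVn] <;> ring
      rw [hlin, hVn]
      rcases le_or_gt y n with hy | hy
      · rw [hpe y hy, if_neg (by omega)]; ring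
      · obtain ⟨y, rfl⟩ : ∃ z, y = z + 1 := ⟨y - 1, by omega⟩
        rw [jacobiLeft, hp0 (y + 1) hy, hp0 (y + 2) (by omega)]
        split_ifs with h
        · obtain rfl : y = n := by omega
          ring
        · rw [hp0 y (by omega)]; ring
    refine ⟨fun i => if i < n then m i else μ,
      fun i => if i ≤ n then V i else fun y => jacobiLeft u a d (V n) y - μ * V n y,
      ?_, ?_, ?_, ?_, ?_, ?_, ?_⟩
    · intro y
      simp only [Nat.zero_le, if_true]
      rcases Nat.eq_zero_or_pos y with rfl | hy
      · simp [hV, hSdiag 0 (Nat.zero_le n), hw.zero, hp00.ne']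
      · simp [hV, hStail 0 (Nat.zero_le n) y hy, hy.ne']
    · intro i hi y
      rcases Nat.lt_or_ge i n with h | h
      · simp only [h, h.le, Nat.succ_le_of_lt h, if_true]
        exact hVsucc i h y
      · obtain rfl : i = n := by omega
        simp
    · intro i hi y
      split_ifs with h
      · exact mul_nonneg (div_nonneg (hpnn y) hp00.le) (hSnn i h y)
      · beta_reduce
        rw [hnew]
        split_ifs
        exacts [mul_nonneg hcpos.le (mul_nonneg (hpnn n) (hu n (by omega)).le), le_rfl]
    · intro i hi y hy
      split_ifs with h
      · simp [hV, hStail i h y hy]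
      · beta_reduce
        rw [hnew, if_neg (by omega)]
    · intro i hi
      split_ifs with h
      · simp only [hV, hSdiag i h]
        exact mul_pos (div_pos (hp i h) hp00) (hw.diag i h)
      · beta_reduce
        rw [hnew, if_pos (by omega)]
        exact mul_pos hcpos (mul_pos (hp n le_rfl) (hu n (by omega)))
    · intro y hy
      simp only [show ¬ n + 1 ≤ n by omega, if_false]
      rw [hnew, if_neg (by omega)]
    · intro i hi
      rw [if_pos (by omega)]
      split_ifs with h
      · exact hw.lt i h
      · -- Summing the recurrence over all states shows that `μ - m i` has the sign of the mass.
        obtain rfl : n = i + 1 := by omega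
        have e := hSsucc i (by omega) 0 (by omega)
        simp only [if_true] at e
        have h1 : 0 < S (i + 1) 0 := by
          refine lt_of_lt_of_le (hw.diag (i + 1) le_rfl) ?_
          exact Finset.single_le_sum (f := w (i + 1)) (fun x _ => hw.nonneg _ le_rfl x)
            (by simp)
        have h2 : 0 ≤ w i 0 * d' 0 := mul_nonneg (hw.nonneg i (by omega) 0)
          (div_nonneg (mul_nonneg (hpnn _) (hd 1 le_rfl (by omega)).le) hp00.le)
        have h3 := hSnn i (by omega) 0
        by_contra hcon
        have := mul_nonpos_of_nonpos_of_nonneg (sub_nonpos.2 (not_lt.1 hcon)) h3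
        linarith

/-! ### The action of a birth-and-death generator on row and column vectors -/

lemma sum_bdGenerator_mul (N : ℕ) (b d f : ℕ → ℝ) (x : Fin (N + 1)) :
    ∑ y : Fin (N + 1), bdGenerator N b d x y * f y =
      (if (x : ℕ) < N then b (x + 1) * (f (x + 1) - f x) else 0) +
        (if 0 < (x : ℕ) then d x * (f (x - 1) - f x) else 0) := by
  obtain ⟨x, hx⟩ := x
  have h : ∀ y : Fin (N + 1), bdGenerator N b d ⟨x, hx⟩ y * f y =
      (if (y : ℕ) = x + 1 then b (x + 1) * f (x + 1) else 0) +
      (if (y : ℕ) + 1 = x then d x * f (x - 1) else 0) +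
      (if (y : ℕ) = x then
        -((if (x : ℕ) < N then b (x + 1) else 0) + (if 0 < (x : ℕ) then d x else 0)) * f x
        else 0) := by
    rintro ⟨y, hy⟩
    simp only [bdGenerator, Matrix.of_apply, Fin.mk.injEq]
    rcases lt_trichotomy y x with h | h | h
    · by_cases h' : y + 1 = x
      · subst h'; simp [show y ≠ y + 1 + 1 by omega]
      · simp [h.ne, h', show y ≠ x + 1 by omega]
    · subst h; simp
    · by_cases h' : y = x + 1
      · subst h'; simp [show x + 1 + 1 ≠ x by omega]
      · simp [h.ne', h', show y + 1 ≠ x by omega]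
  rw [Finset.sum_congr rfl fun y _ => h y,
    Fin.sum_univ_eq_sum_range (fun y => (if y = x + 1 then b (x + 1) * f (x + 1) else 0) +
      (if y + 1 = x then d x * f (x - 1) else 0) +
      (if y = x then
        -((if x < N then b (x + 1) else 0) + (if 0 < x then d x else 0)) * f x else 0)),
    Finset.sum_add_distrib, Finset.sum_add_distrib, Finset.sum_ite_eq', Finset.sum_ite_eq',
    if_pos (Finset.mem_range.2 hx)]
  cases x with
  | zero => simp; split_ifs <;> ring
  | succ x =>
    simp only [add_left_inj, Finset.sum_ite_eq', Finset.mem_range]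
    rw [if_pos (show x < N + 1 by omega)]
    simp only [Nat.add_lt_add_iff_right, Nat.succ_pos, if_true, Nat.add_sub_cancel]
    split_ifs <;> ring

lemma sum_mul_bdGenerator (N : ℕ) (b d f : ℕ → ℝ) (y : Fin (N + 1)) :
    ∑ x : Fin (N + 1), f x * bdGenerator N b d x y =
      (if 0 < (y : ℕ) then f (y - 1) * b y else 0) +
      (if (y : ℕ) < N then f (y + 1) * d (y + 1) else 0) -
      f y * ((if (y : ℕ) < N then b (y + 1) else 0) + (if 0 < (y : ℕ) then d y else 0)) := by
  obtain ⟨y, hy⟩ := y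
  have h : ∀ x : Fin (N + 1), f x * bdGenerator N b d x ⟨y, hy⟩ =
      (if (x : ℕ) + 1 = y then f (y - 1) * b y else 0) +
      (if (x : ℕ) = y + 1 then f (y + 1) * d (y + 1) else 0) +
      (if (x : ℕ) = y then
        -(f y * ((if y < N then b (y + 1) else 0) + (if 0 < y then d y else 0)))
        else 0) := by
    rintro ⟨x, hx⟩
    simp only [bdGenerator, Matrix.of_apply, Fin.mk.injEq]
    rcases lt_trichotomy x y with h | h | h
    · by_cases h' : x + 1 = y
      · subst h'; simp [show x ≠ x + 1 + 1 by omega]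
      · simp [h.ne, h.ne', h', Ne.symm h', show x ≠ y + 1 by omega, show y + 1 ≠ x by omega]
    · subst h; simp [add_comm, mul_add]
    · by_cases h' : x = y + 1
      · subst h'; simp [show y + 1 + 1 ≠ y by omega, show y ≠ y + 1 + 1 by omega]
      · simp [h.ne, h.ne', h', Ne.symm h', show x + 1 ≠ y by omega, show y ≠ x + 1 by omega]
  rw [Finset.sum_congr rfl fun y _ => h y,
    Fin.sum_univ_eq_sum_range (fun x => (if x + 1 = y then f (y - 1) * b y else 0) +
      (if x = y + 1 then f (y + 1) * d (y + 1) else 0) +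
      (if x = y then
        -(f y * ((if y < N then b (y + 1) else 0) + (if 0 < y then d y else 0))) else 0)),
    Finset.sum_add_distrib, Finset.sum_add_distrib, Finset.sum_ite_eq', Finset.sum_ite_eq',
    if_pos (Finset.mem_range.2 hy)]
  cases y with
  | zero => simp; ring
  | succ y =>
    simp only [add_left_inj, Finset.sum_ite_eq', Finset.mem_range]
    rw [if_pos (show y < N + 1 by omega)]
    simp only [Nat.add_lt_add_iff_right, Nat.succ_pos, if_true, Nat.add_sub_cancel]
    ring

lemma sum_row_bdGenerator (N : ℕ) (b d : ℕ → ℝ) (x : Fin (N + 1)) :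
    ∑ y, bdGenerator N b d x y = 0 := by
  simpa using sum_bdGenerator_mul N b d (fun _ => 1) x

lemma bdGenerator_congr {N : ℕ} {b b' d : ℕ → ℝ} (h : ∀ x, 1 ≤ x → x ≤ N → b x = b' x) :
    bdGenerator N b d = bdGenerator N b' d := by
  ext ⟨x, hx⟩ ⟨y, hy⟩
  simp only [bdGenerator, Matrix.of_apply, Fin.mk.injEq]
  by_cases h1 : y = x + 1
  · simp only [h1, if_true]; exact h _ (by omega) (by omega)
  · simp only [h1, if_false]
    by_cases h2 : x < N
    · simp only [h2, if_true, h (x + 1) (by omega) (by omega)]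
    · simp [h2]

/-- A function that is subharmonic below `N` for a birth-and-death generator is nondecreasing: the
reflecting boundary at `0` gives the first step, and the generator propagates it. -/
lemma le_succ_of_subharmonic {N : ℕ} {b d : ℕ → ℝ} (hb : ∀ x, 1 ≤ x → x ≤ N → 0 < b x)
    (hd : ∀ x, 1 ≤ x → x < N → 0 < d x) (f : ℕ → ℝ)
    (hf : ∀ x : Fin (N + 1), (x : ℕ) < N →
      0 ≤ ∑ y : Fin (N + 1), bdGenerator N b d x y * f y) (x : ℕ) (hx : x < N) :
    f x ≤ f (x + 1) ∧ ∀ y ≤ x + 1, f 0 ≤ f y := by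
  induction x with
  | zero =>
    have h := hf ⟨0, by omega⟩ hx
    rw [sum_bdGenerator_mul] at h
    simp only [hx, if_true, lt_irrefl, if_false, add_zero, zero_add] at h
    have h1 := nonneg_of_mul_nonneg_right h (hb 1 le_rfl (by omega))
    refine ⟨by simpa using h1, fun y hy => ?_⟩
    interval_cases y
    · exact le_rfl
    · linarith
  | succ x ih =>
    obtain ⟨i1, i2⟩ := ih (by omega)
    have h := hf ⟨x + 1, by omega⟩ hx
    rw [sum_bdGenerator_mul] at h
    simp only [hx, if_true, Nat.succ_pos, Nat.add_sub_cancel] at h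
    have h2 : d (x + 1) * (f x - f (x + 1)) ≤ 0 :=
      mul_nonpos_of_nonneg_of_nonpos (hd _ (by omega) hx).le (by linarith)
    have h1 := nonneg_of_mul_nonneg_right (show 0 ≤ b (x + 1 + 1) * (f (x + 1 + 1) - f (x + 1)) by
      linarith) (hb (x + 1 + 1) (by omega) (by omega))
    refine ⟨by linarith, fun y hy => ?_⟩
    rcases Nat.lt_or_ge y (x + 2) with h | h
    · exact i2 y (by omega)
    · obtain rfl : y = x + 2 := by omega
      have := i2 (x + 1) le_rfl
      rw [show x + 2 = x + 1 + 1 from rfl]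
      linarith

/-! ### Eigenvalues from an intertwining with a pure birth process -/

lemma bdGenerator_zero_death_eq_zero {N : ℕ} (r : ℕ → ℝ) {x y : Fin (N + 1)} (h : y < x) :
    bdGenerator N r 0 x y = 0 := by
  have h' : (y : ℕ) < x := h
  simp [bdGenerator, show (y : ℕ) ≠ x + 1 by omega, h.ne]

lemma bdGenerator_zero_death_diag {N : ℕ} (r : ℕ → ℝ) (x : Fin (N + 1)) :
    bdGenerator N r 0 x x = -(if (x : ℕ) < N then r (x + 1) else 0) := by
  simp [bdGenerator]

/-- If `A K = K B` with `K` invertible and `B` upper triangular, then the eigenvalues of `A` are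
the diagonal entries of `B`. -/
lemma hasEigenvalue_iff_of_intertwining {n : ℕ} {A B K : Matrix (Fin n) (Fin n) ℝ}
    (hK : IsUnit K) (h : A * K = K * B) (hB : ∀ x y, y < x → B x y = 0) (μ : ℝ) :
    Module.End.HasEigenvalue (Matrix.toLin' A) μ ↔ ∃ x, μ = B x x := by
  obtain ⟨K, rfl⟩ := hK
  have hA : A = K.val * B * K⁻¹.val := by
    rw [← h, Matrix.mul_assoc, ← Units.val_mul, mul_inv_cancel, Units.val_one, Matrix.mul_one]
  rw [Module.End.hasEigenvalue_iff_isRoot_charpoly, Matrix.charpoly_toLin', hA,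
    Matrix.coe_units_inv, Matrix.charpoly_units_conj,
    Matrix.charpoly_of_isUpperTriangular B (fun x y hxy => hB x y hxy),
    Polynomial.IsRoot, Polynomial.eval_prod, Finset.prod_eq_zero_iff]
  simp [sub_eq_zero]

lemma isUnit_of_lowerTriangular {n : ℕ} {K : Matrix (Fin n) (Fin n) ℝ}
    (h : ∀ x y, x < y → K x y = 0) (hd : ∀ x, 0 < K x x) : IsUnit K := by
  rw [Matrix.isUnit_iff_isUnit_det, Matrix.det_of_isLowerTriangular K (fun x y hxy => h x y hxy)]
  exact (Finset.prod_pos fun x _ => hd x).ne'.isUnit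

/-- Strictly monotone enumerations of the same finite set agree. -/
lemma eqOn_of_enumerate_same {N : ℕ} {e e' : ℕ → ℝ} (he : ∀ i < N, e i < e (i + 1))
    (he' : ∀ i < N, e' i < e' (i + 1)) {S : ℝ → Prop} (h : ∀ μ, S μ ↔ ∃ i ≤ N, μ = -e i)
    (h' : ∀ μ, S μ ↔ ∃ i ≤ N, μ = -e' i) : ∀ i ≤ N, e i = e' i := by
  have mono : ∀ f : ℕ → ℝ, (∀ i < N, f i < f (i + 1)) →
      StrictMono fun i : Fin (N + 1) => f i := fun f hf =>
    Fin.strictMono_iff_lt_succ.2 fun i => by simpa using hf i i.2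
  have hr : Set.range (fun i : Fin (N + 1) => e i) = Set.range fun i : Fin (N + 1) => e' i := by
    have aux : ∀ f : ℕ → ℝ, (∀ μ, S μ ↔ ∃ i ≤ N, μ = -f i) →
        Set.range (fun i : Fin (N + 1) => f i) = {x | S (-x)} := by
      intro f hf
      ext x
      simp only [Set.mem_range, Set.mem_ofPred_eq, hf, neg_inj]
      constructor
      · rintro ⟨i, rfl⟩; exact ⟨i, by omega, rfl⟩
      · rintro ⟨i, hi, rfl⟩; exact ⟨⟨i, by omega⟩, rfl⟩
    rw [aux e h, aux e' h']
  have := ((mono e he).range_inj (mono e' he')).1 hr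
  exact fun i hi => congrFun this ⟨i, by omega⟩

lemma isTriangularKernel_of {N : ℕ} {K : Matrix (Fin (N + 1)) (Fin (N + 1)) ℝ}
    (hnn : ∀ x y, 0 ≤ K x y) (hsum : ∀ x, ∑ y, K x y = 1) (htri : ∀ x y, x < y → K x y = 0)
    (hlast : K (Fin.last N) (Fin.last N) = 1) : IsTriangularKernel K where
  stochastic := Matrix.mem_rowStochastic_iff_sum.2 ⟨hnn, hsum⟩
  triangular x := by
    rw [← hsum x]
    exact Finset.sum_subset (Finset.subset_univ _) fun y _ hy =>
      htri x y (by simpa using hy)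
  last := hlast

/-! ### The intertwining kernels -/

/-- The rows of `K⁺` are the normalised spectral products `δ₀ (G + λ_N) (G + λ_{N-1}) ⋯`. -/
theorem exists_kernel_plus (N : ℕ) (b d : ℕ → ℝ) (hb : ∀ x, 1 ≤ x → x ≤ N → 0 < b x)
    (hd : ∀ x, 1 ≤ x → x < N → 0 < d x) (hdN : d N = 0) :
    ∃ (ev : ℕ → ℝ) (K : Matrix (Fin (N + 1)) (Fin (N + 1)) ℝ),
      ev 0 = 0 ∧ (∀ i < N, ev i < ev (i + 1)) ∧ IsTriangularKernel K ∧
      K * bdGenerator N b d = bdGenerator N (fun x => ev (N + 1 - x)) 0 * K ∧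
      ∀ μ, Module.End.HasEigenvalue (Matrix.toLin' (bdGenerator N b d)) μ ↔
        ∃ i ≤ N, μ = -ev i := by
  set a : ℕ → ℝ := fun x => -(b (x + 1) + if 0 < x then d x else 0) with ha
  obtain ⟨m, v, hv⟩ := exists_isSpectralProduct N (fun x => b (x + 1)) a d
    (fun x hx => hb _ (by omega) (by omega)) hd
  set s : ℕ → ℝ := fun i => ∑ y : Fin (N + 1), v i y with hs
  have hspos : ∀ i ≤ N, 0 < s i := fun i hi =>
    (hv.diag i hi).trans_le (Finset.single_le_sum (f := fun y : Fin (N + 1) => v i y)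
      (fun y _ => hv.nonneg i hi y) (Finset.mem_univ ⟨i, by omega⟩))
  have hG : ∀ i < N, ∀ y : Fin (N + 1),
      ∑ x : Fin (N + 1), v i x * bdGenerator N b d x y = v (i + 1) y + m i * v i y := by
    rintro i hi ⟨y, hy⟩
    have hz : ∀ x, N ≤ x → v i x = 0 := fun x hx => hv.supp i hi.le x (by omega)
    rw [sum_mul_bdGenerator, hv.succ i hi]
    simp only [ha]
    rcases Nat.lt_or_ge y N with h | h
    · cases y with
      | zero => simp [h, jacobiLeft]; ring
      | succ y => simp [h, jacobiLeft]; ring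
    · obtain rfl : y = N := by omega
      cases y with
      | zero => omega
      | succ y => simp [jacobiLeft, hz (y + 1) le_rfl, hz (y + 2) (by omega)]
  have hssucc : ∀ i < N, s (i + 1) = -m i * s i := by
    intro i hi
    have h1 : ∑ y : Fin (N + 1), ∑ x : Fin (N + 1), v i x * bdGenerator N b d x y = 0 := by
      rw [Finset.sum_comm]
      simp only [← Finset.mul_sum, sum_row_bdGenerator, mul_zero, Finset.sum_const_zero]
    rw [Finset.sum_congr rfl fun y _ => hG i hi y, Finset.sum_add_distrib, ← Finset.mul_sum] at h1
    simp only [hs]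
    linarith
  have hm : ∀ i < N, 0 < -m i := fun i hi =>
    pos_of_mul_pos_left (by rw [← hssucc i hi]; exact hspos _ (by omega)) (hspos i hi.le).le
  set ev : ℕ → ℝ := fun k => if k = 0 then 0 else -m (N - k) with hev
  set K : Matrix (Fin (N + 1)) (Fin (N + 1)) ℝ := Matrix.of fun i y => v i y / s i with hK
  have hevm : ∀ i < N, ev (N - i) = -m i := fun i hi => by
    simp [hev, show N - i ≠ 0 by omega, show N - (N - i) = i by omega]
  have htri : ∀ x y, x < y → K x y = 0 := fun x y hxy => by
    simp [hK, hv.supp x (by omega) y hxy]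
  have hdiag : ∀ x, 0 < K x x := fun x => div_pos (hv.diag x (by omega)) (hspos x (by omega))
  have hnn : ∀ x y, 0 ≤ K x y := fun x y =>
    div_nonneg (hv.nonneg x (by omega) y) (hspos x (by omega)).le
  have hsum : ∀ x, ∑ y, K x y = 1 := fun x => by
    simp only [hK, Matrix.of_apply, ← Finset.sum_div]
    exact div_self (hspos x (by omega)).ne'
  have hNlast : ∀ y : Fin (N + 1), (y : ℕ) ≠ N → K (Fin.last N) y = 0 := fun y hy => by
    simp [hK, hv.last y (by omega)]
  have hlast : K (Fin.last N) (Fin.last N) = 1 := by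
    rw [← hsum (Fin.last N), Finset.sum_eq_single (Fin.last N)]
    · intro y _ hy
      exact hNlast y fun h => hy (Fin.ext h)
    · simp
  have hint : K * bdGenerator N b d = bdGenerator N (fun x => ev (N + 1 - x)) 0 * K := by
    ext i y
    rw [Matrix.mul_apply, Matrix.mul_apply,
      show ∑ j, bdGenerator N (fun x => ev (N + 1 - x)) 0 i j * K j y =
        ∑ j : Fin (N + 1), bdGenerator N (fun x => ev (N + 1 - x)) 0 i j * (v j y / s j) from rfl,
      sum_bdGenerator_mul N _ _ (fun j => v j y / s j)]
    simp only [Pi.zero_apply, zero_mul, ite_self, add_zero]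
    split_ifs with hi
    · have h1 : ∑ j, K i j * bdGenerator N b d j y =
          (∑ x : Fin (N + 1), v i x * bdGenerator N b d x y) / s i := by
        rw [Finset.sum_div]
        exact Finset.sum_congr rfl fun j _ => by simp only [hK, Matrix.of_apply]; ring
      rw [h1, hG i hi, show N + 1 - (i + 1 : ℕ) = N - i by omega, hevm i hi, hssucc i hi]
      have h2 := (hspos i hi.le).ne'
      have h3 := (hm i hi).ne'
      rw [neg_ne_zero] at h3
      field_simp
      ring
    · obtain rfl : i = Fin.last N := Fin.ext (by simp; omega)
      rw [Finset.sum_eq_single (Fin.last N)]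
      · rw [hlast, one_mul]
        by_cases h2 : (y : ℕ) + 1 = N
        · simp [bdGenerator, h2, hdN, show (y : ℕ) ≠ N + 1 by omega]
        · by_cases h3 : y = Fin.last N
          · simp [bdGenerator, h3, hdN]
          · simp [bdGenerator, h2, h3, show (y : ℕ) ≠ N + 1 by omega]
      · intro j _ hj
        rw [hNlast j fun h => hj (Fin.ext h), zero_mul]
      · simp
  have hunit := isUnit_of_lowerTriangular htri hdiag
  refine ⟨ev, K, by simp [hev], fun i hi => ?_, isTriangularKernel_of hnn hsum htri hlast, hint,
    fun μ => ?_⟩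
  · rcases Nat.eq_zero_or_pos i with rfl | h
    · simpa [hev] using hm (N - 1) (by omega)
    · have := hv.lt (N - (i + 1)) (by omega)
      simp only [hev, h.ne', Nat.succ_ne_zero, if_false]
      rw [show N - (i + 1) + 1 = N - i by omega] at this
      linarith
  · obtain ⟨U, hU⟩ := hunit
    have h' : bdGenerator N b d * U⁻¹.val =
        U⁻¹.val * bdGenerator N (fun x => ev (N + 1 - x)) 0 := by
      rw [← hU] at hint
      calc bdGenerator N b d * U⁻¹.val
          = U⁻¹.val * (U.val * bdGenerator N b d) * U⁻¹.val := by
            rw [← Matrix.mul_assoc U⁻¹.val, ← Units.val_mul, inv_mul_cancel, Units.val_one,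
              Matrix.one_mul]
        _ = U⁻¹.val * bdGenerator N (fun x => ev (N + 1 - x)) 0 := by
            rw [hint, Matrix.mul_assoc, Matrix.mul_assoc, ← Units.val_mul, mul_inv_cancel,
              Units.val_one, Matrix.mul_one]
    rw [hasEigenvalue_iff_of_intertwining (Units.isUnit U⁻¹) h'
      (fun x y hxy => bdGenerator_zero_death_eq_zero _ hxy)]
    simp only [bdGenerator_zero_death_diag]
    constructor
    · rintro ⟨x, rfl⟩
      split_ifs with hx
      · exact ⟨N - x, by omega, by rw [show N + 1 - (x + 1 : ℕ) = N - x by omega]⟩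
      · exact ⟨0, by omega, by simp [hev]⟩
    · rintro ⟨i, hi, rfl⟩
      refine ⟨⟨N - i, by omega⟩, ?_⟩
      simp only
      split_ifs with h
      · rw [show N + 1 - (N - i + 1) = i by omega]
      · obtain rfl : i = 0 := by omega
        simp [hev]

/-- The columns of `K⁻` are multiples of the spectral products `(G + λ_{y+2}) ⋯ (G + λ_N) G δ_N`;
below `N` these are spectral products of the transposed generator, with the states `0, …, N-1`
in reversed order. -/
theorem exists_kernel_minus (N : ℕ) (b d : ℕ → ℝ) (hb : ∀ x, 1 ≤ x → x ≤ N → 0 < b x)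
    (hd : ∀ x, 1 ≤ x → x < N → 0 < d x) (hdN : d N = 0) :
    ∃ (ev : ℕ → ℝ) (K : Matrix (Fin (N + 1)) (Fin (N + 1)) ℝ),
      ev 0 = 0 ∧ (∀ i < N, ev i < ev (i + 1)) ∧ IsTriangularKernel K ∧
      bdGenerator N b d * K = K * bdGenerator N ev 0 ∧
      ∀ μ, Module.End.HasEigenvalue (Matrix.toLin' (bdGenerator N b d)) μ ↔
        ∃ i ≤ N, μ = -ev i := by
  set a : ℕ → ℝ := fun z => -(b (N - z) + if 0 < N - 1 - z then d (N - 1 - z) else 0) with ha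
  -- The value `1` at the exit state keeps all rates positive; it only affects the last product.
  obtain ⟨m, w, hw⟩ := exists_isSpectralProduct N
    (fun z => if z + 1 < N then b (N - 1 - z) else 1) a (fun z => d (N - z))
    (fun z hz => by
      split_ifs with h
      exacts [hb _ (by omega) (by omega), one_pos])
    (fun z h1 h2 => hd _ (by omega) (by omega))
  set c : ℕ → ℕ → ℝ := fun y x => if x = N then 0 else w (N - 1 - y) (N - 1 - x) with hc
  have hcG : ∀ y < N, ∀ x : Fin (N + 1),
      ∑ x' : Fin (N + 1), bdGenerator N b d x x' * c y x' =
        (if 0 < y then c (y - 1) x else 0) + m (N - 1 - y) * c y x := by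
    rintro y hy ⟨x, hx⟩
    rw [sum_bdGenerator_mul]
    simp only
    rcases Nat.lt_or_ge x N with h | h
    · have hsucc := hw.succ (N - 1 - y) (by omega) (N - 1 - x)
      have e1 : (if 0 < y then c (y - 1) x else 0) = w (N - 1 - y + 1) (N - 1 - x) := by
        split_ifs with hy0
        · simp only [hc, h.ne, if_false]
          rw [show N - 1 - (y - 1) = N - 1 - y + 1 by omega]
        · rw [show N - 1 - y + 1 = N by omega, hw.last _ (by omega)]
      rw [e1, hsucc]
      simp only [hc, ha, h, h.ne, if_true, if_false]
      have hx1 : (if x + 1 = N then 0 else w (N - 1 - y) (N - 1 - (x + 1))) =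
          if x + 1 = N then 0 else w (N - 1 - y) (N - 1 - x - 1) := by
        rw [show N - 1 - (x + 1) = N - 1 - x - 1 by omega]
      have hN0 : w (N - 1 - y) N = 0 := hw.supp _ (by omega) _ (by omega)
      rw [hx1]
      obtain ⟨z, hz⟩ : ∃ z, N - 1 - x = z := ⟨_, rfl⟩
      obtain rfl : x = N - 1 - z := by omega
      rw [hz]
      have e2 : (if 0 < N - 1 - z then d (N - 1 - z) *
            ((if N - 1 - z - 1 = N then 0 else w (N - 1 - y) (N - 1 - (N - 1 - z - 1))) -
              w (N - 1 - y) z) else 0) =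
          w (N - 1 - y) (z + 1) * d (N - (z + 1)) -
            (if 0 < N - 1 - z then d (N - 1 - z) else 0) * w (N - 1 - y) z := by
        split_ifs with g1 g2
        · omega
        · rw [show N - 1 - (N - 1 - z - 1) = z + 1 by omega,
            show N - (z + 1) = N - 1 - z by omega]
          ring
        · rw [show z + 1 = N by omega, hN0]; ring
      rw [e2, show N - 1 - z + 1 = N - z by omega]
      cases z with
      | zero =>
        simp only [jacobiLeft]
        rw [if_pos (by omega)]
        generalize (if 0 < N - 1 - 0 then d (N - 1 - 0) else 0) = D
        simp
        ring
      | succ z =>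
        simp only [jacobiLeft]
        generalize (if 0 < N - 1 - (z + 1) then d (N - 1 - (z + 1)) else 0) = D
        rw [if_neg (by omega), if_pos (show z + 1 < N by omega),
          show N - (z + 1) = N - 1 - z by omega]
        simp
        ring
    · obtain rfl : x = N := by omega
      simp [hc, hdN]
  have hcN : ∀ y < N, c y N = 0 := fun y _ => by simp [hc]
  have hcnn : ∀ y < N, ∀ x, 0 ≤ c y x := fun y hy x => by
    simp only [hc]
    split_ifs
    exacts [le_rfl, hw.nonneg _ (by omega) _]
  have hcdiag : ∀ y < N, 0 < c y y := fun y hy => by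
    simp only [hc, hy.ne, if_false]
    exact hw.diag _ (by omega)
  have hctri : ∀ y < N, ∀ x < y, c y x = 0 := fun y hy x hx => by
    simp only [hc, (hx.trans hy).ne, if_false]
    exact hw.supp _ (by omega) _ (by omega)
  -- The first column is a nonnegative eigenvector vanishing at `N`: its eigenvalue is negative.
  have hmlast : ∀ i < N, m i < 0 := by
    intro i hi
    have hlast : m (N - 1) < 0 := by
      by_contra hcon
      rw [not_lt] at hcon
      have h := (le_succ_of_subharmonic hb hd (c 0) (fun x hx => by
        rw [hcG 0 (by omega)]
        simpa using mul_nonneg hcon (hcnn 0 (by omega) x)) (N - 1) (by omega)).2 N (by omega)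
      rw [hcN 0 (by omega)] at h
      exact absurd (hcdiag 0 (by omega)) (not_lt.2 h)
    have hmono : ∀ j, j ≤ N - 1 - i → m i ≤ m (i + j) := by
      intro j
      induction j with
      | zero => intro _; exact le_rfl
      | succ j ih => intro hj; exact (ih (by omega)).trans (hw.lt (i + j) (by omega)).le
    have := hmono (N - 1 - i) le_rfl
    rw [show i + (N - 1 - i) = N - 1 by omega] at this
    exact this.trans_lt hlast
  set ev : ℕ → ℝ := fun k => if k = 0 then 0 else -m (N - k) with hev
  have hevpos : ∀ k, 1 ≤ k → k ≤ N → 0 < ev k := fun k h1 h2 => by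
    simp only [hev, show k ≠ 0 by omega, if_false]
    linarith [hmlast (N - k) (by omega)]
  -- The factor of column `y`, which turns the coefficient `1` of `c (y - 1)` in `hcG` into `ev y`.
  set γ : ℕ → ℝ := fun y => b N * ∏ k ∈ Finset.Ico (y + 1) (N + 1), (ev k)⁻¹ with hγ
  have hγsucc : ∀ y < N, γ y * ev (y + 1) = γ (y + 1) := fun y hy => by
    simp only [hγ]
    rw [Finset.prod_eq_prod_Ico_succ_bot (by omega)]
    have := (hevpos (y + 1) (by omega) (by omega)).ne'
    field_simp
  have hγN : γ N = b N := by simp [hγ]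
  have hγpos : ∀ y < N, 0 < γ y := fun y hy =>
    mul_pos (hb N (by omega) le_rfl) (Finset.prod_pos fun k hk => by
      rw [Finset.mem_Ico] at hk
      exact inv_pos.2 (hevpos k (by omega) (by omega)))
  set F : ℕ → ℕ → ℝ := fun x y => if y = N then (if x = N then 1 else 0) else γ y * c y x with hF
  set K : Matrix (Fin (N + 1)) (Fin (N + 1)) ℝ := Matrix.of fun x y => F x y with hK
  have hFlt : ∀ y < N, ∀ x, F x y = γ y * c y x := fun y hy x => by simp [hF, hy.ne]
  have hint : bdGenerator N b d * K = K * bdGenerator N ev 0 := by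
    ext x y
    rw [Matrix.mul_apply, Matrix.mul_apply,
      show ∑ j, K x j * bdGenerator N ev 0 j y =
        ∑ j : Fin (N + 1), F x j * bdGenerator N ev 0 j y from rfl,
      sum_mul_bdGenerator N _ _ (fun j => F x j),
      show ∑ j, bdGenerator N b d x j * K j y =
        ∑ j : Fin (N + 1), bdGenerator N b d x j * F j y from rfl]
    simp only [Pi.zero_apply, mul_zero, ite_self, add_zero]
    obtain ⟨y, hy⟩ := y
    simp only
    rcases Nat.lt_or_ge y N with h | h
    · simp only [hFlt y h, h, if_true]
      have h1 : ∑ j : Fin (N + 1), bdGenerator N b d x j * (γ y * c y j) =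
          γ y * ∑ j : Fin (N + 1), bdGenerator N b d x j * c y j := by
        rw [Finset.mul_sum]
        exact Finset.sum_congr rfl fun j _ => by ring
      have h2 : m (N - 1 - y) = -ev (y + 1) := by
        simp [hev, show N - (y + 1) = N - 1 - y by omega]
      rw [h1, hcG y h, h2]
      split_ifs with h0
      · rw [hFlt (y - 1) (by omega), ← show γ (y - 1) * ev y = γ y by
          have := hγsucc (y - 1) (by omega)
          rwa [show y - 1 + 1 = y by omega] at this]
        ring
      · ring
    · obtain rfl : y = N := by omega
      have h1 : ∀ j, F j y = if j = y then 1 else 0 := fun j => by simp [hF]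
      simp only [h1, lt_irrefl, if_false, mul_zero, sub_zero]
      rw [sum_bdGenerator_mul _ b d (fun j => if j = y then 1 else 0)]
      obtain ⟨x, hx⟩ := x
      simp only
      rcases lt_trichotomy (x + 1) y with g | g | g
      · have h2 := hctri (y - 1) (by omega) x (by omega)
        simp [g.ne, show x ≠ y by omega, show x - 1 ≠ y by omega, hFlt (y - 1) (by omega), h2]
      · have := hγsucc (y - 1) (by omega)
        rw [show y - 1 + 1 = y by omega, hγN] at this
        have h2 : c (y - 1) x = 1 := by
          simp [hc, show x ≠ y by omega, hw.zero, show y - 1 - x = 0 by omega]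
        rw [if_pos (show 0 < y by omega), hFlt (y - 1) (by omega), h2, if_pos (show x < y by omega),
          if_pos g, if_neg (show x ≠ y by omega), if_neg (show x - 1 ≠ y by omega), g, ← this]
        simp
      · obtain rfl : x = y := by omega
        rcases Nat.eq_zero_or_pos x with h0 | h0
        · simp [h0]
        · simp [h0, hdN, hFlt (x - 1) (by omega), hcN (x - 1) (by omega)]
  have hnn : ∀ x y, 0 ≤ K x y := fun x y => by
    simp only [hK, hF, Matrix.of_apply]
    split_ifs
    exacts [zero_le_one, le_rfl, mul_nonneg (hγpos y (by omega)).le (hcnn y (by omega) x)]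
  have hFtri : ∀ x y, x < y → y ≤ N → F x y = 0 := fun x y hxy hy => by
    rcases hy.lt_or_eq with h | h
    · rw [hFlt y h, hctri y h x hxy, mul_zero]
    · simp [hF, h, show x ≠ N by omega]
  have hFN : ∀ y < N, F N y = 0 := fun y hy => by rw [hFlt y hy, hcN y hy, mul_zero]
  have hdiag : ∀ x, 0 < K x x := fun x => by
    simp only [hK, hF, Matrix.of_apply]
    split_ifs
    exacts [one_pos, mul_pos (hγpos x (by omega)) (hcdiag x (by omega))]
  -- The row sums are harmonic, hence constant.
  set s : ℕ → ℝ := fun x => ∑ y : Fin (N + 1), F x y with hs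
  have hharm : ∀ x : Fin (N + 1), ∑ x' : Fin (N + 1), bdGenerator N b d x x' * s x' = 0 := by
    intro x
    have h1 : ∑ x' : Fin (N + 1), bdGenerator N b d x x' * s x' =
        ∑ y, (bdGenerator N b d * K) x y := by
      simp only [hs, Matrix.mul_apply, Finset.mul_sum]
      rw [Finset.sum_comm]
      rfl
    rw [h1, hint]
    simp only [Matrix.mul_apply]
    rw [Finset.sum_comm]
    simp only [← Finset.mul_sum, sum_row_bdGenerator, mul_zero, Finset.sum_const_zero]
  have hsN : s N = 1 := by
    simp only [hs]
    rw [Finset.sum_eq_single (Fin.last N)]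
    · simp [hF]
    · intro y _ hy
      exact hFN y (lt_of_le_of_ne (by omega) fun h => hy (Fin.ext h))
    · simp
  have hsum : ∀ x ≤ N, s x = 1 := by
    intro x hx
    induction hx using Nat.decreasingInduction with
    | self => exact hsN
    | of_succ x hx ih =>
      have h1 := (le_succ_of_subharmonic hb hd s (fun x _ => (hharm x).ge) x hx).1
      have h2 := (le_succ_of_subharmonic hb hd (fun x => -s x) (fun x _ => by
        simp only [mul_neg, Finset.sum_neg_distrib, hharm, neg_zero, le_refl]) x hx).1
      rw [← ih]
      exact le_antisymm h1 (neg_le_neg_iff.1 h2)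
  refine ⟨ev, K, by simp [hev], fun i hi => ?_, isTriangularKernel_of hnn
    (fun x => hsum x (by omega)) (fun x y hxy => hFtri x y hxy (by omega)) (by simp [hK, hF]),
    hint, fun μ => ?_⟩
  · rcases Nat.eq_zero_or_pos i with rfl | h
    · simpa [hev] using hevpos 1 le_rfl (by omega)
    · have := hw.lt (N - (i + 1)) (by omega)
      simp only [hev, h.ne', Nat.succ_ne_zero, if_false]
      rw [show N - (i + 1) + 1 = N - i by omega] at this
      linarith
  · rw [hasEigenvalue_iff_of_intertwining
      (isUnit_of_lowerTriangular (fun x y hxy => hFtri x y hxy (by omega)) hdiag) hint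
      (fun x y hxy => bdGenerator_zero_death_eq_zero _ hxy)]
    simp only [bdGenerator_zero_death_diag]
    constructor
    · rintro ⟨x, rfl⟩
      split_ifs with hx
      · exact ⟨x + 1, by omega, rfl⟩
      · exact ⟨0, by omega, by simp [hev]⟩
    · rintro ⟨i, hi, rfl⟩
      rcases Nat.eq_zero_or_pos i with rfl | h
      · exact ⟨Fin.last N, by simp [hev]⟩
      · refine ⟨⟨i - 1, by omega⟩, ?_⟩
        simp only
        rw [if_pos (by omega), show i - 1 + 1 = i by omega]

/-- The eigenvalues and the two intertwining kernels of a birth-and-death process. -/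
theorem exists_eigenvalues_kernels (N : ℕ) (b d : ℕ → ℝ) (hb : ∀ x, 1 ≤ x → x ≤ N → 0 < b x)
    (hd : ∀ x, 1 ≤ x → x < N → 0 < d x) (hdN : d N = 0) :
    ∃ (ev : ℕ → ℝ) (Km Kp : Matrix (Fin (N + 1)) (Fin (N + 1)) ℝ),
      ev 0 = 0 ∧ (∀ i < N, ev i < ev (i + 1)) ∧
      (∀ μ : ℝ, Module.End.HasEigenvalue (Matrix.toLin' (bdGenerator N b d)) μ ↔
        ∃ i, i ≤ N ∧ μ = -ev i) ∧
      IsTriangularKernel Km ∧ IsTriangularKernel Kp ∧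
      Kp * bdGenerator N b d = bdGenerator N (fun x => ev (N + 1 - x)) 0 * Kp ∧
      bdGenerator N b d * Km = Km * bdGenerator N ev 0 := by
  obtain ⟨ev, Kp, h0, hlt, hKp, hint, hspec⟩ := exists_kernel_plus N b d hb hd hdN
  obtain ⟨ev', Km, h0', hlt', hKm, hint', hspec'⟩ := exists_kernel_minus N b d hb hd hdN
  have heq := eqOn_of_enumerate_same hlt hlt' hspec hspec'
  refine ⟨ev, Km, Kp, h0, hlt, hspec, hKm, hKp, hint, ?_⟩
  rw [hint', bdGenerator_congr fun x _ hx => heq x hx]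

/-! ### Intertwined and coupled transition matrices -/

section Coupling

variable {U V W : Type*}

/-- The kernel from `U` to `U × V` that keeps the first coordinate and draws the second from `K`. -/
def graphKernel [DecidableEq U] (K : Matrix U V ℝ) : Matrix U (U × V) ℝ :=
  Matrix.of fun u p => if p.1 = u then K u p.2 else 0

/-- The deterministic kernel of the map `f`. -/
def mapKernel [DecidableEq V] (f : U → V) : Matrix U V ℝ :=
  Matrix.of fun u v => if f u = v then 1 else 0

lemma mapKernel_mul [Fintype V] [DecidableEq V] (f : U → V) (M : Matrix V W ℝ) (u : U) (w : W) :
    (mapKernel f * M) u w = M (f u) w := by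
  simp [mapKernel, Matrix.mul_apply]

lemma mul_mapKernel [Fintype U] [DecidableEq V] (f : U → V) (M : Matrix W U ℝ) (w : W) (v : V) :
    (M * mapKernel f) w v = ∑ u with f u = v, M w u := by
  simp [mapKernel, Matrix.mul_apply, Finset.sum_filter]

/-- The Diaconis–Fill coupling of two transition matrices `Q`, `R` that are intertwined by `K`,
`K R = Q K`: the second coordinate moves according to `R`, and, given its new value `v'`, the first
coordinate moves from `u` to `u'` with probability `Q u u' * K u' v' / (K R) u v'`. Where this is
`0 / 0` the first coordinate stays put. -/
noncomputable def coupledMatrix [Fintype V] [DecidableEq U] (Q : Matrix U U ℝ)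
    (R : Matrix V V ℝ) (K : Matrix U V ℝ) : Matrix (U × V) (U × V) ℝ :=
  Matrix.of fun p q => R p.2 q.2 * if (K * R) p.1 q.2 = 0 then (if q.1 = p.1 then 1 else 0)
    else Q p.1 q.1 * K q.1 q.2 / (K * R) p.1 q.2

variable [Fintype U] [Fintype V] [DecidableEq U] {Q : Matrix U U ℝ} {R : Matrix V V ℝ}
  {K : Matrix U V ℝ}

lemma sum_coupledMatrix_fst (h : K * R = Q * K) (p : U × V) (v' : V) :
    ∑ u', coupledMatrix Q R K p (u', v') = R p.2 v' := by
  simp only [coupledMatrix, Matrix.of_apply, ← Finset.mul_sum]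
  split_ifs with h0
  · simp
  · rw [← Finset.sum_div, ← Matrix.mul_apply, ← h, div_self h0, mul_one]

lemma coupledMatrix_mem_rowStochastic [DecidableEq V] (h : K * R = Q * K)
    (hQ : Q ∈ Matrix.rowStochastic ℝ U)
    (hR : R ∈ Matrix.rowStochastic ℝ V) (hK : ∀ u v, 0 ≤ K u v) :
    coupledMatrix Q R K ∈ Matrix.rowStochastic ℝ (U × V) := by
  rw [Matrix.mem_rowStochastic_iff_sum] at *
  refine ⟨fun p q => ?_, fun p => ?_⟩
  · refine mul_nonneg (hR.1 _ _) ?_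
    split_ifs
    exacts [zero_le_one, le_rfl, div_nonneg (mul_nonneg (hQ.1 _ _) (hK _ _))
      (Finset.sum_nonneg fun v _ => mul_nonneg (hK _ _) (hR.1 _ _))]
  · rw [Fintype.sum_prod_type_right]
    simp only [sum_coupledMatrix_fst h, hR.2]

/-- The second coordinate of the coupling is autonomous, with transition matrix `R`. -/
lemma coupledMatrix_mul_mapKernel [DecidableEq V] (h : K * R = Q * K) :
    coupledMatrix Q R K * (mapKernel Prod.snd : Matrix (U × V) V ℝ) =
      (mapKernel Prod.snd : Matrix (U × V) V ℝ) * R := by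
  ext p v'
  rw [mapKernel_mul, ← sum_coupledMatrix_fst h, Matrix.mul_apply, Fintype.sum_prod_type_right]
  simp [mapKernel]

/-- The coupling is intertwined with the chain of the first coordinate by `graphKernel K`: if the
second coordinate has conditional law `K` given the first, then this persists after one step. -/
lemma graphKernel_mul_coupledMatrix (h : K * R = Q * K) (hQ : ∀ u u', 0 ≤ Q u u')
    (hK : ∀ u v, 0 ≤ K u v) :
    graphKernel K * coupledMatrix Q R K = Q * graphKernel K := by
  ext u q
  have h1 : (graphKernel K * coupledMatrix Q R K) u q =
      (∑ v, K u v * R v q.2) * if (K * R) u q.2 = 0 then (if q.1 = u then 1 else 0)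
        else Q u q.1 * K q.1 q.2 / (K * R) u q.2 := by
    rw [Matrix.mul_apply, Fintype.sum_prod_type_right, Finset.sum_mul]
    refine Finset.sum_congr rfl fun v _ => ?_
    rw [Finset.sum_eq_single u]
    · simp [graphKernel, coupledMatrix, mul_assoc]
    · intro u' _ hu'
      simp [graphKernel, hu']
    · simp
  have h2 : (Q * graphKernel K) u q = Q u q.1 * K q.1 q.2 := by
    rw [Matrix.mul_apply, Finset.sum_eq_single q.1]
    · simp [graphKernel]
    · intro u' _ hu'
      simp [graphKernel, hu'.symm]
    · simp
  rw [h1, h2, ← Matrix.mul_apply]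
  by_cases h0 : (K * R) u q.2 = 0
  · rw [h0, zero_mul]
    rw [h, Matrix.mul_apply, Finset.sum_eq_zero_iff_of_nonneg
      fun u' _ => mul_nonneg (hQ _ _) (hK _ _)] at h0
    exact (h0 q.1 (Finset.mem_univ _)).symm
  · rw [if_neg h0]
    field_simp

end Coupling

/-! ### Matrix exponentials -/

section Exponential

variable {S T : Type*} [Fintype S] [Fintype T] [DecidableEq S] [DecidableEq T]

lemma hasSum_matrix_exp (A : Matrix T T ℝ) :
    HasSum (fun n : ℕ => ((n.factorial : ℝ)⁻¹) • A ^ n) (NormedSpace.exp A) := by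
  let : NormedRing (Matrix T T ℝ) := Matrix.linftyOpNormedRing
  let : NormedAlgebra ℝ (Matrix T T ℝ) := Matrix.linftyOpNormedAlgebra
  exact NormedSpace.exp_series_hasSum_exp' A

/-- Intertwining relations pass to the semigroups. -/
lemma mul_exp_of_intertwining {Λ : Matrix S T ℝ} {A : Matrix T T ℝ} {B : Matrix S S ℝ}
    (h : Λ * A = B * Λ) : Λ * NormedSpace.exp A = NormedSpace.exp B * Λ := by
  have hpow : ∀ n : ℕ, Λ * A ^ n = B ^ n * Λ := by
    intro n
    induction n with
    | zero => simp
    | succ n ih => rw [pow_succ, ← Matrix.mul_assoc, ih, Matrix.mul_assoc, h, pow_succ,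
        Matrix.mul_assoc]
  have h1 := (hasSum_matrix_exp A).map (AddMonoidHom.mk' (fun M => Λ * M) (Matrix.mul_add Λ))
    (continuous_const.matrix_mul continuous_id)
  have h2 := (hasSum_matrix_exp B).map
    (AddMonoidHom.mk' (fun M => M * Λ) (fun M M' => Matrix.add_mul M M' Λ))
    (continuous_id.matrix_mul continuous_const)
  refine h1.unique (h2.congr_fun ?_)
  intro n
  simp [hpow]

lemma mul_exp_smul_of_intertwining {Λ : Matrix S T ℝ} {A : Matrix T T ℝ} {B : Matrix S S ℝ}
    (h : Λ * A = B * Λ) (t : ℝ) :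
    Λ * NormedSpace.exp (t • A) = NormedSpace.exp (t • B) * Λ :=
  mul_exp_of_intertwining (by rw [Matrix.mul_smul, h, Matrix.smul_mul])

/-- Uniformisation: the semigroup generated by `r (P - 1)` is a Poisson mixture of powers of `P`. -/
lemma hasSum_exp_uniformized (P : Matrix T T ℝ) (r t : ℝ) (x y : T) :
    HasSum (fun n : ℕ => Real.exp (-(r * t)) * (r * t) ^ n / n.factorial * (P ^ n) x y)
      (NormedSpace.exp (t • (r • (P - 1))) x y) := by
  have h1 : NormedSpace.exp (t • (r • (P - 1))) =
      Real.exp (-(r * t)) • NormedSpace.exp ((r * t) • P) := by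
    have : t • (r • (P - 1)) = (-(r * t)) • (1 : Matrix T T ℝ) + (r * t) • P := by
      rw [smul_smul, smul_sub, neg_smul, mul_comm t r]; abel
    rw [this, Matrix.exp_add_of_commute _ _ (by
      exact ((Commute.one_left P).smul_left _).smul_right _)]
    have h2 : NormedSpace.exp ((-(r * t)) • (1 : Matrix T T ℝ)) = Real.exp (-(r * t)) • 1 := by
      rw [Matrix.smul_one_eq_diagonal, Matrix.exp_diagonal, Matrix.smul_one_eq_diagonal]
      congr 1
      ext i
      rw [Pi.coe_exp, Real.exp_eq_exp_ℝ]
    rw [h2, Matrix.smul_mul, Matrix.one_mul]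
  have h3 := hasSum_matrix_exp ((r * t) • P)
  have h4 := (Pi.hasSum.1 (Pi.hasSum.1 h3 x) y).mul_left (Real.exp (-(r * t)))
  rw [h1, Matrix.smul_apply, smul_eq_mul]
  refine h4.congr_fun fun n => ?_
  simp only [smul_pow, Matrix.smul_apply, smul_eq_mul]
  ring

lemma sum_row_exp {T : Type*} [Fintype T] [DecidableEq T] {A : Matrix T T ℝ}
    (hA : ∀ x, ∑ y, A x y = 0) (t : ℝ) (x : T) : ∑ y, NormedSpace.exp (t • A) x y = 1 := by
  have h := mul_exp_smul_of_intertwining (Λ := mapKernel (fun _ : T => ()))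
    (A := (0 : Matrix Unit Unit ℝ)) (B := A) (by
      ext x y
      rw [mul_mapKernel]
      simp [hA]) t
  have h1 := congrFun (congrFun h x) ()
  rw [mul_mapKernel, mapKernel_mul] at h1
  simpa using h1.symm

end Exponential

/-! ### Sequences of independent clocks and random maps -/

section Seq

variable {α : Type*}

/-- The sequence `x, ω 0, ω 1, …`. -/
def seqCons (x : α) (ω : ℕ → α) : ℕ → α
  | 0 => x
  | n + 1 => ω n

variable [MeasurableSpace α]

lemma measurable_seqCons : Measurable fun p : α × (ℕ → α) => seqCons p.1 p.2 := by
  refine measurable_pi_iff.2 fun n => ?_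
  cases n with
  | zero => exact measurable_fst
  | succ n => exact (measurable_pi_apply n).comp measurable_snd

lemma map_seqCons_infinitePi (ν : Measure α) [IsProbabilityMeasure ν] :
    (ν.prod (Measure.infinitePi fun _ : ℕ => ν)).map (fun p => seqCons p.1 p.2) =
      Measure.infinitePi fun _ : ℕ => ν := by
  refine Measure.eq_infinitePi _ fun s t ht => ?_
  set s' : Finset ℕ := s.preimage Nat.succ Nat.succ_injective.injOn with hs'
  have hpre : (fun p : α × (ℕ → α) => seqCons p.1 p.2) ⁻¹' (Set.pi s t) =
      (if 0 ∈ s then t 0 else Set.univ) ×ˢ Set.pi s' (fun k => t (k + 1)) := by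
    ext ⟨x, ω⟩
    simp only [Set.mem_preimage, Set.mem_pi, Set.mem_prod, Finset.mem_coe, hs',
      Finset.mem_preimage, Nat.succ_eq_add_one]
    constructor
    · intro h
      refine ⟨?_, fun i hi => h (i + 1) hi⟩
      split_ifs with h0
      exacts [h 0 h0, Set.mem_univ _]
    · rintro ⟨h0, h1⟩ i hi
      cases i with
      | zero => rw [if_pos hi] at h0; exact h0
      | succ i => exact h1 i hi
  rw [Measure.map_apply measurable_seqCons (MeasurableSet.pi s.countable_toSet fun i _ => ht i),
    hpre, Measure.prod_prod, Measure.infinitePi_pi _ (fun i _ => ht (i + 1))]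
  have himg : s'.image Nat.succ = s.erase 0 := by
    ext i
    simp only [hs', Finset.mem_image, Finset.mem_preimage, Finset.mem_erase]
    constructor
    · rintro ⟨j, hj, rfl⟩; exact ⟨Nat.succ_ne_zero j, hj⟩
    · rintro ⟨h0, hi⟩
      exact ⟨i - 1, by rwa [Nat.succ_eq_add_one, Nat.sub_add_cancel (by omega)], by omega⟩
  have hprod : ∏ i ∈ s', ν (t (i + 1)) = ∏ i ∈ s.erase 0, ν (t i) := by
    rw [← himg, Finset.prod_image fun _ _ _ _ h => Nat.succ_injective h]
  rw [hprod]
  split_ifs with h0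
  · exact Finset.mul_prod_erase s (fun i => ν (t i)) h0
  · rw [measure_univ, one_mul, Finset.erase_eq_of_notMem h0]

end Seq

/-! ### Two integrals of the exponential distribution -/

section Exp

open ProbabilityTheory

lemma lintegral_expMeasure (r : ℝ) {f : ℝ → ENNReal} (hf : Measurable f) :
    ∫⁻ e, f e ∂(expMeasure r) = ∫⁻ e, exponentialPDF r e * f e := by
  have hm : Measurable (exponentialPDF r) :=
    (measurable_exponentialPDFReal r).ennreal_ofReal
  exact lintegral_withDensity_eq_lintegral_mul _ hm hf

lemma ae_pos_expMeasure (r : ℝ) : ∀ᵐ e ∂(expMeasure r), 0 < e := by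
  have hm : Measurable (exponentialPDF r) :=
    (measurable_exponentialPDFReal r).ennreal_ofReal
  refine (ae_withDensity_iff (f := exponentialPDF r) hm).2 ?_
  filter_upwards [Measure.ae_ne volume (0 : ℝ)] with e he h
  rcases lt_trichotomy e 0 with h' | h' | h'
  · exact absurd (exponentialPDF_of_neg h') h
  · exact absurd h' he
  · exact h'

/-- The lack of memory of the exponential distribution. -/
lemma lintegral_expMeasure_memoryless {r t : ℝ} (ht : 0 ≤ t) {f : ℝ → ENNReal}
    (hf : Measurable f) :
    ∫⁻ e, (if t < e then f (e - t) else 0) ∂(expMeasure r) =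
      ENNReal.ofReal (Real.exp (-(r * t))) * ∫⁻ e, f e ∂(expMeasure r) := by
  have hg : Measurable fun e => if t < e then f (e - t) else 0 :=
    Measurable.ite measurableSet_Ioi (hf.comp (measurable_id.sub_const t)) measurable_const
  rw [lintegral_expMeasure r hg, lintegral_expMeasure r hf,
    ← lintegral_const_mul' _ _ ENNReal.ofReal_ne_top,
    ← lintegral_sub_right_eq_self _ (-t)]
  refine lintegral_congr_ae ?_
  filter_upwards [Measure.ae_ne volume (0 : ℝ)] with e he
  simp only [sub_neg_eq_add, add_sub_cancel_right]
  rcases lt_or_gt_of_ne he with h | h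
  · rw [exponentialPDF_of_neg h, if_neg (by linarith)]
    simp
  · rw [exponentialPDF_of_nonneg h.le, exponentialPDF_of_nonneg (by linarith),
      if_pos (by linarith), ← mul_assoc, ← ENNReal.ofReal_mul (Real.exp_pos _).le]
    congr 2
    rw [mul_left_comm, ← Real.exp_add]
    congr 2
    ring

/-- The probability that a Poisson process with rate `r` has made `n` jumps at time `t`; this is
zero for negative `t`. -/
noncomputable def poissonWeight (r : ℝ) (n : ℕ) (t : ℝ) : ℝ :=
  if 0 ≤ t then Real.exp (-(r * t)) * (r * t) ^ n / n.factorial else 0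

lemma poissonWeight_nonneg {r : ℝ} (hr : 0 < r) (n : ℕ) (t : ℝ) : 0 ≤ poissonWeight r n t := by
  unfold poissonWeight
  split_ifs
  · positivity
  · exact le_rfl

lemma measurable_poissonWeight (r : ℝ) (n : ℕ) : Measurable (poissonWeight r n) :=
  Measurable.ite measurableSet_Ici (by fun_prop) measurable_const

/-- The renewal equation for the Poisson weights, obtained by conditioning on the first jump. -/
lemma lintegral_poissonWeight {r : ℝ} (hr : 0 < r) (n : ℕ) (t : ℝ) :
    ∫⁻ e, ENNReal.ofReal (poissonWeight r n (t - e)) ∂(expMeasure r) =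
      ENNReal.ofReal (poissonWeight r (n + 1) t) := by
  have hm : Measurable fun e => ENNReal.ofReal (poissonWeight r n (t - e)) :=
    ((measurable_poissonWeight r n).comp (measurable_const.sub measurable_id)).ennreal_ofReal
  rw [lintegral_expMeasure r hm]
  have h1 : ∀ e, exponentialPDF r e * ENNReal.ofReal (poissonWeight r n (t - e)) =
      (Set.Icc 0 t).indicator (fun e => ENNReal.ofReal
        (Real.exp (-(r * t)) * r ^ (n + 1) / n.factorial * (t - e) ^ n)) e := by
    intro e
    by_cases h0 : 0 ≤ e
    · by_cases h2 : e ≤ t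
      · rw [Set.indicator_of_mem (Set.mem_Icc.2 ⟨h0, h2⟩), exponentialPDF_of_nonneg h0,
          ← ENNReal.ofReal_mul (by positivity), poissonWeight, if_pos (by linarith)]
        congr 1
        have : Real.exp (-(r * t)) = Real.exp (-(r * e)) * Real.exp (-(r * (t - e))) := by
          rw [← Real.exp_add]; congr 1; ring
        rw [this, mul_pow]
        ring
      · rw [Set.indicator_of_notMem (fun h => h2 h.2), poissonWeight, if_neg (by linarith)]
        simp
    · rw [Set.indicator_of_notMem (fun h => h0 h.1), exponentialPDF_of_neg (by linarith), zero_mul]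
  rw [lintegral_congr h1, lintegral_indicator measurableSet_Icc]
  rcases lt_or_ge t 0 with ht | ht
  · rw [Set.Icc_eq_empty (by linarith), poissonWeight, if_neg (by linarith)]
    simp
  · rw [← ofReal_integral_eq_lintegral_ofReal]
    · congr 1
      rw [integral_Icc_eq_integral_Ioc, ← intervalIntegral.integral_of_le ht,
        intervalIntegral.integral_const_mul,
        intervalIntegral.integral_comp_sub_left (fun x => x ^ n), integral_pow, poissonWeight,
        if_pos ht, mul_pow, Nat.factorial_succ]
      have : (n.factorial : ℝ) ≠ 0 := by positivity
      push_cast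
      field_simp
      simp
    · exact (by fun_prop : Continuous fun e : ℝ =>
        Real.exp (-(r * t)) * r ^ (n + 1) / n.factorial * (t - e) ^ n).integrableOn_Icc
    · refine (ae_restrict_iff' measurableSet_Icc).2 (Filter.Eventually.of_forall fun e he => ?_)
      have : 0 ≤ t - e := by linarith [he.2]
      positivity

end Exp

/-! ### The uniformized Markov jump process -/

section Jump

variable {T : Type*}

/-- The time of the `n`-th jump, when `(ω i).1` is the waiting time before jump `i + 1`. -/
noncomputable def jumpTime (ω : ℕ → ℝ × (T → T)) (n : ℕ) : ℝ := ∑ i ∈ Finset.range n, (ω i).1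

/-- The state after `n` jumps of the chain started in `z`, which applies the map `(ω i).2` at its
jump `i + 1`. -/
def jumpState : ℕ → (ℕ → ℝ × (T → T)) → T → T
  | 0, _, z => z
  | n + 1, ω, z => jumpState n (fun k => ω (k + 1)) ((ω 0).2 z)

/-- The clocks and maps as seen from time `t`, if exactly `n` jumps occur up to time `t`. -/
noncomputable def jumpShift (t : ℝ) (n : ℕ) (ω : ℕ → ℝ × (T → T)) : ℕ → ℝ × (T → T) :=
  seqCons (jumpTime ω (n + 1) - t, (ω n).2) fun k => ω (n + 1 + k)

lemma jumpTime_zero (ω : ℕ → ℝ × (T → T)) : jumpTime ω 0 = 0 := by simp [jumpTime]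

lemma jumpTime_succ (ω : ℕ → ℝ × (T → T)) (n : ℕ) :
    jumpTime ω (n + 1) = jumpTime ω n + (ω n).1 := Finset.sum_range_succ _ _

lemma jumpTime_seqCons (x : ℝ × (T → T)) (ω : ℕ → ℝ × (T → T)) (n : ℕ) :
    jumpTime (seqCons x ω) (n + 1) = x.1 + jumpTime ω n := by
  rw [jumpTime, Finset.sum_range_succ', add_comm]
  rfl

lemma jumpState_congr (n : ℕ) {ω ω' : ℕ → ℝ × (T → T)} (h : ∀ i, (ω i).2 = (ω' i).2) (z : T) :
    jumpState n ω z = jumpState n ω' z := by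
  induction n generalizing ω ω' z with
  | zero => rfl
  | succ n ih => rw [jumpState, jumpState, h 0, ih fun i => h (i + 1)]

lemma jumpState_add (n k : ℕ) (ω : ℕ → ℝ × (T → T)) (z : T) :
    jumpState (n + k) ω z = jumpState k (fun i => ω (n + i)) (jumpState n ω z) := by
  induction n generalizing ω z with
  | zero => simp [jumpState]
  | succ n ih =>
    rw [show n + 1 + k = n + k + 1 by ring, jumpState, ih, jumpState]
    congr 1
    ext i : 1
    rw [show n + 1 + i = n + i + 1 by ring]

lemma jumpShift_seqCons (t : ℝ) (n : ℕ) (x : ℝ × (T → T)) (ω : ℕ → ℝ × (T → T)) :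
    jumpShift t (n + 1) (seqCons x ω) = jumpShift (t - x.1) n ω := by
  unfold jumpShift
  rw [jumpTime_seqCons]
  ext i : 1
  cases i with
  | zero => simp only [seqCons]; ext1 <;> simp; ring
  | succ i => exact congrArg (seqCons x ω) (show n + 1 + 1 + i = n + 1 + i + 1 by ring)

lemma jumpTime_jumpShift (t : ℝ) (n k : ℕ) (ω : ℕ → ℝ × (T → T)) :
    jumpTime (jumpShift t n ω) (k + 1) = jumpTime ω (n + (k + 1)) - t := by
  rw [jumpShift, jumpTime_seqCons]
  simp only [jumpTime]
  rw [show n + (k + 1) = n + 1 + k by ring, Finset.sum_range_add _ (n + 1) k]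
  ring

lemma jumpState_jumpShift (t : ℝ) (n k : ℕ) (ω : ℕ → ℝ × (T → T)) (z : T) :
    jumpState k (jumpShift t n ω) (jumpState n ω z) = jumpState (n + k) ω z := by
  rw [jumpState_add]
  refine jumpState_congr k (fun i => ?_) _
  cases i with
  | zero => rfl
  | succ i => rw [jumpShift, seqCons, show n + 1 + i = n + (i + 1) by ring]

/-- The event that a chain started in `z` has made `n` jumps at time `t` and is then in `z'`, and
that the clocks and maps as seen from time `t` are in `B`. -/
def jumpEvent (n : ℕ) (t : ℝ) (z z' : T) (B : Set (ℕ → ℝ × (T → T))) : Set (ℕ → ℝ × (T → T)) :=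
  {ω | jumpTime ω n ≤ t ∧ t < jumpTime ω (n + 1) ∧ jumpState n ω z = z' ∧ jumpShift t n ω ∈ B}

lemma seqCons_mem_jumpEvent_succ (n : ℕ) (t : ℝ) (z z' : T) (B : Set (ℕ → ℝ × (T → T)))
    (x : ℝ × (T → T)) (ω : ℕ → ℝ × (T → T)) :
    seqCons x ω ∈ jumpEvent (n + 1) t z z' B ↔ ω ∈ jumpEvent n (t - x.1) (x.2 z) z' B := by
  simp only [jumpEvent, Set.mem_ofPred_eq, jumpTime_seqCons, jumpShift_seqCons, jumpState]
  rw [le_sub_iff_add_le', sub_lt_iff_lt_add']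
  rfl

variable [MeasurableSpace T]

lemma measurable_jumpTime (n : ℕ) : Measurable fun ω : ℕ → ℝ × (T → T) => jumpTime ω n :=
  Finset.measurable_sum _ fun i _ => measurable_fst.comp (measurable_pi_apply i)

lemma measurable_jumpShift (t : ℝ) (n : ℕ) :
    Measurable fun ω : ℕ → ℝ × (T → T) => jumpShift t n ω := by
  refine measurable_pi_iff.2 fun i => ?_
  cases i with
  | zero =>
    have h : Measurable fun ω : ℕ → ℝ × (T → T) => (ω n).2 :=
      measurable_snd.comp (measurable_pi_apply n)
    exact ((measurable_jumpTime (n + 1)).sub_const t).prodMk h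
  | succ i => exact measurable_pi_apply (n + 1 + i)

variable [Fintype T]

/-- A transition matrix, as a family of measures on a finite set. -/
noncomputable def rowMeasure (P : Matrix T T ℝ) (z : T) : Measure T :=
  ∑ w, ENNReal.ofReal (P z w) • Measure.dirac w

lemma isProbabilityMeasure_rowMeasure [DecidableEq T] {P : Matrix T T ℝ}
    (hP : P ∈ Matrix.rowStochastic ℝ T) (z : T) : IsProbabilityMeasure (rowMeasure P z) := by
  rw [Matrix.mem_rowStochastic_iff_sum] at hP
  constructor
  simp only [rowMeasure, Measure.coe_finsetSum, Finset.sum_apply, Measure.smul_apply,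
    measure_univ, smul_eq_mul, mul_one]
  rw [← ENNReal.ofReal_sum_of_nonneg fun w _ => hP.1 z w, hP.2, ENNReal.ofReal_one]

/-- The joint law of an exponential waiting time and of a random map that moves each state `z`
according to the row `P z`. -/
noncomputable def stepMeasure (r : ℝ) (P : Matrix T T ℝ) : Measure (ℝ × (T → T)) :=
  (ProbabilityTheory.expMeasure r).prod (Measure.pi (rowMeasure P))

/-- The law of the clocks and maps that drive the jump process. -/
noncomputable def jumpMeasure (r : ℝ) (P : Matrix T T ℝ) : Measure (ℕ → ℝ × (T → T)) :=
  Measure.infinitePi fun _ => stepMeasure r P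

lemma isProbabilityMeasure_stepMeasure [DecidableEq T] {r : ℝ} {P : Matrix T T ℝ}
    (hr : 0 < r) (hP : P ∈ Matrix.rowStochastic ℝ T) :
    IsProbabilityMeasure (stepMeasure r P) := by
  have := isProbabilityMeasure_rowMeasure hP
  have := ProbabilityTheory.isProbabilityMeasure_expMeasure hr
  unfold stepMeasure
  infer_instance

lemma isProbabilityMeasure_jumpMeasure [DecidableEq T] {r : ℝ} {P : Matrix T T ℝ}
    (hr : 0 < r) (hP : P ∈ Matrix.rowStochastic ℝ T) :
    IsProbabilityMeasure (jumpMeasure r P) := by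
  have := isProbabilityMeasure_stepMeasure hr hP
  unfold jumpMeasure
  infer_instance

lemma jumpMeasure_eq_lintegral [DecidableEq T] {r : ℝ} {P : Matrix T T ℝ} (hr : 0 < r)
    (hP : P ∈ Matrix.rowStochastic ℝ T) {B : Set (ℕ → ℝ × (T → T))} (hB : MeasurableSet B) :
    jumpMeasure r P B =
      ∫⁻ x, jumpMeasure r P {ω | seqCons x ω ∈ B} ∂(stepMeasure r P) := by
  have := isProbabilityMeasure_stepMeasure hr hP
  have := isProbabilityMeasure_jumpMeasure hr hP
  have h := map_seqCons_infinitePi (stepMeasure r P)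
  change (_ : Measure _) = jumpMeasure r P at h
  conv_lhs => rw [← h]
  rw [Measure.map_apply measurable_seqCons hB, Measure.prod_apply (measurable_seqCons hB)]
  rfl

variable [DiscreteMeasurableSpace T]

lemma lintegral_rowMeasure (P : Matrix T T ℝ) (z : T) (f : T → ENNReal) :
    ∫⁻ w, f w ∂(rowMeasure P z) = ∑ w, ENNReal.ofReal (P z w) * f w := by
  simp [rowMeasure, lintegral_finsetSum_measure, lintegral_smul_measure]

lemma measurable_jumpState (n : ℕ) (z : T) :
    Measurable fun ω : ℕ → ℝ × (T → T) => jumpState n ω z := by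
  induction n generalizing z with
  | zero => exact measurable_const
  | succ n ih =>
    have h1 : Measurable fun p : (ℕ → ℝ × (T → T)) × T =>
        jumpState n (fun k => p.1 (k + 1)) p.2 :=
      measurable_from_prod_countable_left fun y =>
        (ih y).comp (measurable_pi_iff.2 fun k => measurable_pi_apply (k + 1))
    exact h1.comp (measurable_id.prodMk
      ((measurable_pi_apply z).comp (measurable_snd.comp (measurable_pi_apply 0))))

lemma measurableSet_jumpEvent (n : ℕ) (t : ℝ) (z z' : T) {B : Set (ℕ → ℝ × (T → T))}
    (hB : MeasurableSet B) : MeasurableSet (jumpEvent n t z z' B) :=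
  (measurableSet_le (measurable_jumpTime n) measurable_const).inter
    ((measurableSet_lt measurable_const (measurable_jumpTime (n + 1))).inter
      (((measurable_jumpState n z) (measurableSet_singleton z')).inter
        (measurable_jumpShift t n hB)))

variable [DecidableEq T] {r : ℝ} {P : Matrix T T ℝ}

/-- Regeneration at time `t`: the number of jumps is Poisson, the state is a power of `P`, and what
is seen from time `t` is independent of this and has the original law. -/
theorem jumpMeasure_jumpEvent (hr : 0 < r) (hP : P ∈ Matrix.rowStochastic ℝ T) (n : ℕ) (t : ℝ)
    (z z' : T) {B : Set (ℕ → ℝ × (T → T))} (hB : MeasurableSet B) :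
    jumpMeasure r P (jumpEvent n t z z' B) =
      ENNReal.ofReal (poissonWeight r n t) * ENNReal.ofReal ((P ^ n) z z') *
        jumpMeasure r P B := by
  have hprob := isProbabilityMeasure_rowMeasure hP
  have := isProbabilityMeasure_stepMeasure hr hP
  have := isProbabilityMeasure_jumpMeasure hr hP
  have := ProbabilityTheory.isProbabilityMeasure_expMeasure hr
  induction n generalizing t z with
  | zero =>
    rw [pow_zero]
    by_cases hz : 0 ≤ t ∧ z = z'
    · obtain ⟨ht, rfl⟩ := hz
      rw [jumpMeasure_eq_lintegral hr hP (measurableSet_jumpEvent 0 t z z hB),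
        jumpMeasure_eq_lintegral hr hP hB]
      set g : ℝ × (T → T) → ENNReal := fun x => jumpMeasure r P {ω | seqCons x ω ∈ B} with hg
      have hgm : Measurable g := measurable_measure_prodMk_left (measurable_seqCons hB)
      have h1 : ∀ x : ℝ × (T → T), jumpMeasure r P {ω | seqCons x ω ∈ jumpEvent 0 t z z B} =
          if t < x.1 then g (x.1 - t, x.2) else 0 := by
        intro x
        have hmem : ∀ ω, seqCons x ω ∈ jumpEvent 0 t z z B ↔
            t < x.1 ∧ seqCons (x.1 - t, x.2) ω ∈ B := by
          intro ω
          have hs : jumpShift t 0 (seqCons x ω) = seqCons (x.1 - t, x.2) ω := by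
            rw [jumpShift, jumpTime_seqCons, jumpTime_zero, add_zero]
            ext i : 1
            cases i with
            | zero => rfl
            | succ i => exact congrArg (seqCons x ω) (show 0 + 1 + i = i + 1 by ring)
          simp only [jumpEvent, Set.mem_ofPred_eq, hs, jumpTime_seqCons, jumpTime_zero, jumpState]
          simp [ht]
        simp only [hmem]
        split_ifs with h
        · simp only [h, true_and, hg]
        · simp [h]
      rw [lintegral_congr h1, stepMeasure, lintegral_prod_symm _ (by
          refine Measurable.aemeasurable (Measurable.ite (measurable_fst measurableSet_Ioi) ?_
            measurable_const)
          exact hgm.comp ((measurable_fst.sub_const t).prodMk measurable_snd)),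
        lintegral_prod_symm _ hgm.aemeasurable]
      have h2 : ∀ φ : T → T, ∫⁻ e, (if t < e then g (e - t, φ) else 0)
          ∂(ProbabilityTheory.expMeasure r) = ENNReal.ofReal (Real.exp (-(r * t))) *
            ∫⁻ e, g (e, φ) ∂(ProbabilityTheory.expMeasure r) := fun φ =>
        lintegral_expMeasure_memoryless ht (f := fun e => g (e, φ))
          (hgm.comp (measurable_id.prodMk measurable_const))
      simp only [h2]
      rw [lintegral_const_mul' _ _ ENNReal.ofReal_ne_top]
      simp [poissonWeight, ht]
    · have h1 : jumpEvent 0 t z z' B = ∅ := by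
        ext ω
        simp only [jumpEvent, jumpTime_zero, jumpState, Set.mem_ofPred_eq, Set.mem_empty_iff_false,
          iff_false]
        exact fun h => hz ⟨h.1, h.2.2.1⟩
      rw [h1, measure_empty]
      by_cases ht : 0 ≤ t
      · rw [Matrix.one_apply_ne fun h => hz ⟨ht, h⟩]; simp
      · simp [poissonWeight, ht]
  | succ n ih =>
    rw [jumpMeasure_eq_lintegral hr hP (measurableSet_jumpEvent (n + 1) t z z' hB)]
    have h1 : ∀ x : ℝ × (T → T), jumpMeasure r P {ω | seqCons x ω ∈ jumpEvent (n + 1) t z z' B} =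
        ENNReal.ofReal (poissonWeight r n (t - x.1)) *
          (ENNReal.ofReal ((P ^ n) (x.2 z) z') * jumpMeasure r P B) := by
      intro x
      simp only [seqCons_mem_jumpEvent_succ, Set.ofPred_mem_eq]
      rw [ih, mul_assoc]
    have hm : Measurable fun φ : T → T => ENNReal.ofReal ((P ^ n) (φ z) z') * jumpMeasure r P B :=
      .of_discrete
    have hm' : Measurable fun e => ENNReal.ofReal (poissonWeight r n (t - e)) :=
      ((measurable_poissonWeight r n).comp (measurable_const.sub measurable_id)).ennreal_ofReal
    rw [lintegral_congr h1, stepMeasure,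
      lintegral_prod_mul (f := fun e => ENNReal.ofReal (poissonWeight r n (t - e)))
        (g := fun φ : T → T => ENNReal.ofReal ((P ^ n) (φ z) z') * jumpMeasure r P B)
        hm'.aemeasurable hm.aemeasurable,
      lintegral_poissonWeight hr, mul_assoc]
    congr 1
    rw [lintegral_mul_const _ .of_discrete]
    congr 1
    have hmp := measurePreserving_eval (rowMeasure P) z
    have h2 := hmp.lintegral_comp (f := fun w => ENNReal.ofReal ((P ^ n) w z')) .of_discrete
    simp only [Function.eval] at h2
    rw [h2, lintegral_rowMeasure, pow_succ', Matrix.mul_apply]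
    have hPn : P ^ n ∈ Matrix.rowStochastic ℝ T := pow_mem hP n
    rw [Matrix.mem_rowStochastic_iff_sum] at hP hPn
    rw [ENNReal.ofReal_sum_of_nonneg fun w _ => mul_nonneg (hP.1 _ _) (hPn.1 _ _)]
    exact Finset.sum_congr rfl fun w _ => (ENNReal.ofReal_mul (hP.1 _ _)).symm

end Jump

section Uniformized

variable {T : Type*} [Fintype T] [DecidableEq T] {r : ℝ} {P : Matrix T T ℝ}

lemma tsum_poissonWeight_mul (hr : 0 < r) (hP : P ∈ Matrix.rowStochastic ℝ T) {t : ℝ} (ht : 0 ≤ t)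
    (z z' : T) :
    ∑' n, ENNReal.ofReal (poissonWeight r n t) * ENNReal.ofReal ((P ^ n) z z') =
      ENNReal.ofReal (NormedSpace.exp (t • (r • (P - 1))) z z') := by
  have h := hasSum_exp_uniformized P r t z z'
  have hPn : ∀ n : ℕ, 0 ≤ (P ^ n) z z' := fun n =>
    Matrix.nonneg_of_mem_rowStochastic (pow_mem hP n)
  rw [← h.tsum_eq, ENNReal.ofReal_tsum_of_nonneg (fun n => mul_nonneg (by positivity) (hPn n))
    h.summable]
  refine tsum_congr fun n => ?_
  rw [← ENNReal.ofReal_mul (poissonWeight_nonneg hr n t), poissonWeight, if_pos ht]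

lemma exp_uniformized_nonneg (hr : 0 < r) (hP : P ∈ Matrix.rowStochastic ℝ T) {t : ℝ}
    (ht : 0 ≤ t) (z z' : T) : 0 ≤ NormedSpace.exp (t • (r • (P - 1))) z z' :=
  (hasSum_exp_uniformized P r t z z').nonneg fun n => mul_nonneg (by positivity)
    (Matrix.nonneg_of_mem_rowStochastic (pow_mem hP n))

lemma sum_row_uniformized (hP : P ∈ Matrix.rowStochastic ℝ T) (z : T) :
    ∑ z', (r • (P - 1)) z z' = 0 := by
  rw [Matrix.mem_rowStochastic_iff_sum] at hP
  simp [← Finset.mul_sum, Finset.sum_sub_distrib, hP.2, Matrix.one_apply]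

end Uniformized

section Jump

variable {T : Type*}

/-- The clocks are positive and the jump times are unbounded. -/
structure IsRegularClock (ω : ℕ → ℝ × (T → T)) : Prop where
  pos : ∀ i, 0 < (ω i).1
  unbounded : ∀ t, ∃ n, t < jumpTime ω n

lemma jumpTime_mono {ω : ℕ → ℝ × (T → T)} (h : ∀ i, 0 < (ω i).1) : Monotone (jumpTime ω) :=
  monotone_nat_of_le_succ fun n => by
    rw [jumpTime_succ]
    linarith [h n]

lemma exists_jumpCount (t : ℝ) (ω : ℕ → ℝ × (T → T)) :
    ∃ n, t < jumpTime ω (n + 1) ∨ ∀ m, jumpTime ω (m + 1) ≤ t := by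
  by_cases h : ∃ n, t < jumpTime ω (n + 1)
  · exact ⟨h.choose, Or.inl h.choose_spec⟩
  · exact ⟨0, Or.inr fun m => not_lt.1 fun hm => h ⟨m, hm⟩⟩

open Classical in
/-- The number of jumps up to time `t`; it is `0` if there are infinitely many. -/
noncomputable def jumpCount (t : ℝ) (ω : ℕ → ℝ × (T → T)) : ℕ := Nat.find (exists_jumpCount t ω)

/-- The state at time `t` of the jump process started in `z`. -/
noncomputable def jumpProcess (t : ℝ) (ω : ℕ → ℝ × (T → T)) (z : T) : T :=
  jumpState (jumpCount t ω) ω z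

/-- The clocks and maps as seen from time `t`. -/
noncomputable def jumpFuture (t : ℝ) (ω : ℕ → ℝ × (T → T)) : ℕ → ℝ × (T → T) :=
  jumpShift t (jumpCount t ω) ω

lemma IsRegularClock.jumpCount_eq_iff {ω : ℕ → ℝ × (T → T)} (h : IsRegularClock ω) {t : ℝ}
    (ht : 0 ≤ t) (n : ℕ) : jumpCount t ω = n ↔ jumpTime ω n ≤ t ∧ t < jumpTime ω (n + 1) := by
  have hb : ¬ ∀ m, jumpTime ω (m + 1) ≤ t := fun hm => by
    obtain ⟨n, hn⟩ := h.unbounded t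
    exact absurd (hn.trans_le (jumpTime_mono h.pos n.le_succ)) (not_lt.2 (hm n))
  classical
  rw [jumpCount, Nat.find_eq_iff]
  simp only [hb, or_false, not_lt]
  constructor
  · rintro ⟨h1, h2⟩
    refine ⟨?_, h1⟩
    cases n with
    | zero => rwa [jumpTime_zero]
    | succ n => exact h2 n n.lt_succ_self
  · rintro ⟨h1, h2⟩
    exact ⟨h2, fun m hm => (jumpTime_mono h.pos hm).trans h1⟩

lemma IsRegularClock.jumpFuture {ω : ℕ → ℝ × (T → T)} (h : IsRegularClock ω) {t : ℝ}
    (ht : 0 ≤ t) : IsRegularClock (jumpFuture t ω) := by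
  obtain ⟨h1, h2⟩ := (h.jumpCount_eq_iff ht _).1 rfl
  constructor
  · intro i
    cases i with
    | zero => exact sub_pos.2 h2
    | succ i => exact h.pos _
  · intro u
    obtain ⟨n, hn⟩ := h.unbounded (u + t)
    refine ⟨n + 1, ?_⟩
    rw [_root_.jumpFuture, jumpTime_jumpShift, lt_sub_iff_add_lt]
    exact hn.trans_le (jumpTime_mono h.pos (by omega))

/-- The flow property of the jump process. -/
lemma IsRegularClock.jumpProcess_add {ω : ℕ → ℝ × (T → T)} (h : IsRegularClock ω) {s u : ℝ}
    (hs : 0 ≤ s) (hu : 0 ≤ u) (z : T) :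
    jumpProcess (s + u) ω z = jumpProcess u (_root_.jumpFuture s ω) (jumpProcess s ω z) := by
  obtain ⟨h1, h2⟩ := (h.jumpCount_eq_iff hs _).1 rfl
  obtain ⟨h3, h4⟩ := ((h.jumpFuture hs).jumpCount_eq_iff hu _).1 rfl
  obtain ⟨k, hk⟩ : ∃ k, jumpCount u (_root_.jumpFuture s ω) = k := ⟨_, rfl⟩
  rw [hk] at h3 h4
  have h5 : jumpCount (s + u) ω = jumpCount s ω + k := by
    rw [h.jumpCount_eq_iff (by linarith)]
    rw [_root_.jumpFuture, jumpTime_jumpShift, lt_sub_iff_add_lt] at h4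
    refine ⟨?_, by rwa [add_comm s u, add_assoc]⟩
    cases k with
    | zero => rw [add_zero]; linarith
    | succ k =>
      rw [_root_.jumpFuture, jumpTime_jumpShift] at h3
      linarith
  rw [jumpProcess, h5, jumpProcess, jumpProcess, hk, _root_.jumpFuture, jumpState_jumpShift]

lemma IsRegularClock.eventually_right {ω : ℕ → ℝ × (T → T)} (h : IsRegularClock ω) (z : T)
    (t : ℝ≥0) : ∀ᶠ s : ℝ≥0 in 𝓝[≥] t, jumpProcess s ω z = jumpProcess t ω z := by
  obtain ⟨h1, h2⟩ := (h.jumpCount_eq_iff t.2 _).1 rfl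
  have h3 : ∀ᶠ s : ℝ≥0 in 𝓝[≥] t, (s : ℝ) < jumpTime ω (jumpCount t ω + 1) :=
    nhdsWithin_le_nhds (NNReal.continuous_coe.continuousAt.eventually (gt_mem_nhds h2))
  filter_upwards [h3, self_mem_nhdsWithin] with s hs hts
  have : jumpCount (s : ℝ) ω = jumpCount t ω :=
    (h.jumpCount_eq_iff s.2 _).2 ⟨h1.trans (NNReal.coe_le_coe.2 hts), hs⟩
  rw [jumpProcess, this, jumpProcess]

lemma IsRegularClock.eventually_left {ω : ℕ → ℝ × (T → T)} (h : IsRegularClock ω) (z : T)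
    (t : ℝ≥0) : ∃ l, ∀ᶠ s : ℝ≥0 in 𝓝[<] t, jumpProcess s ω z = l := by
  rcases eq_zero_or_pos t with rfl | ht
  · exact ⟨z, by simp⟩
  · classical
    have hex : ∃ n, (t : ℝ) ≤ jumpTime ω (n + 1) := by
      obtain ⟨n, hn⟩ := h.unbounded t
      exact ⟨n, hn.le.trans (jumpTime_mono h.pos n.le_succ)⟩
    obtain ⟨n, hn1, hn2⟩ : ∃ n, jumpTime ω n < t ∧ (t : ℝ) ≤ jumpTime ω (n + 1) := by
      refine ⟨Nat.find hex, ?_, Nat.find_spec hex⟩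
      rcases hn : Nat.find hex with _ | n
      · rw [jumpTime_zero]; exact ht
      · exact not_le.1 (Nat.find_min hex (by omega : n < Nat.find hex))
    refine ⟨jumpState n ω z, ?_⟩
    have h3 : ∀ᶠ s : ℝ≥0 in 𝓝[<] t, jumpTime ω n < (s : ℝ) :=
      nhdsWithin_le_nhds (NNReal.continuous_coe.continuousAt.eventually (lt_mem_nhds hn1))
    filter_upwards [h3, self_mem_nhdsWithin] with s hs hts
    have hts' : (s : ℝ) < t := hts
    have : jumpCount (s : ℝ) ω = n := (h.jumpCount_eq_iff s.2 _).2 ⟨hs.le, hts'.trans_le hn2⟩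
    rw [jumpProcess, this]

variable [MeasurableSpace T]

lemma measurableSet_jumpCount (t : ℝ) (n : ℕ) : MeasurableSet {ω : ℕ → ℝ × (T → T) |
    t < jumpTime ω (n + 1) ∨ ∀ m, jumpTime ω (m + 1) ≤ t} := by
  refine (measurableSet_lt measurable_const (measurable_jumpTime _)).union ?_
  have : {ω : ℕ → ℝ × (T → T) | ∀ m, jumpTime ω (m + 1) ≤ t} =
      ⋂ m, {ω | jumpTime ω (m + 1) ≤ t} := by ext; simp
  change MeasurableSet {ω : ℕ → ℝ × (T → T) | ∀ m, jumpTime ω (m + 1) ≤ t}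
  rw [this]
  exact MeasurableSet.iInter fun m => measurableSet_le (measurable_jumpTime _)
    measurable_const

lemma ae_clock_pos [Fintype T] [DecidableEq T] {r : ℝ} {P : Matrix T T ℝ} (hr : 0 < r)
    (hP : P ∈ Matrix.rowStochastic ℝ T) :
    ∀ᵐ ω ∂(jumpMeasure r P), ∀ i, 0 < (ω i).1 := by
  have := isProbabilityMeasure_rowMeasure hP
  have := isProbabilityMeasure_stepMeasure hr hP
  have := ProbabilityTheory.isProbabilityMeasure_expMeasure hr
  refine ae_all_iff.2 fun i => ?_
  have h1 : ∀ᵐ x ∂(stepMeasure r P), 0 < x.1 :=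
    (measurePreserving_fst (μ := ProbabilityTheory.expMeasure r)
      (ν := Measure.pi (rowMeasure P))).quasiMeasurePreserving.ae (ae_pos_expMeasure r)
  exact (measurePreserving_eval_infinitePi (fun _ : ℕ => stepMeasure r P)
    i).quasiMeasurePreserving.ae h1

lemma aedisjoint_jumpEvent [Fintype T] [DecidableEq T] {r : ℝ} {P : Matrix T T ℝ}
    (hr : 0 < r) (hP : P ∈ Matrix.rowStochastic ℝ T) (t : ℝ) (z : T)
    (B : Set (ℕ → ℝ × (T → T))) {p q : ℕ × T} (hpq : p ≠ q) :
    AEDisjoint (jumpMeasure r P) (jumpEvent p.1 t z p.2 B) (jumpEvent q.1 t z q.2 B) := by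
  refine measure_mono_null ?_ (ae_clock_pos hr hP)
  rintro ω ⟨⟨h1, h2, h3, -⟩, ⟨h4, h5, h6, -⟩⟩ hω
  have hm := jumpTime_mono hω
  have : p.1 = q.1 := by
    rcases lt_trichotomy p.1 q.1 with h | h | h
    · exact absurd (h2.trans_le (hm h)) (not_lt.2 h4)
    · exact h
    · exact absurd (h5.trans_le (hm h)) (not_lt.2 h1)
  exact hpq (Prod.ext this (by rw [← h3, ← h6, this]))

lemma measurable_jumpFuture (t : ℝ) :
    Measurable fun ω : ℕ → ℝ × (T → T) => jumpFuture t ω := by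
  classical
  exact Measurable.find (fun n => measurable_jumpShift t n) (measurableSet_jumpCount t)
    (exists_jumpCount t)

variable [Fintype T] [DiscreteMeasurableSpace T]

lemma measurable_jumpProcess (t : ℝ) (z : T) :
    Measurable fun ω : ℕ → ℝ × (T → T) => jumpProcess t ω z := by
  classical
  exact Measurable.find (fun n => measurable_jumpState n z) (measurableSet_jumpCount t)
    (exists_jumpCount t)

variable [DecidableEq T] {r : ℝ} {P : Matrix T T ℝ}

/-- The jump process does not explode, because the Poisson weights sum to `1`. -/
lemma ae_isRegularClock [Nonempty T] (hr : 0 < r) (hP : P ∈ Matrix.rowStochastic ℝ T) :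
    ∀ᵐ ω ∂(jumpMeasure r P), IsRegularClock ω := by
  have := isProbabilityMeasure_jumpMeasure hr hP
  have key : ∀ k : ℕ, ∀ᵐ ω ∂(jumpMeasure r P), ∃ n, (k : ℝ) < jumpTime ω n := by
    intro k
    obtain ⟨z⟩ := ‹Nonempty T›
    have h1 : jumpMeasure r P (⋃ p : ℕ × T, jumpEvent p.1 k z p.2 Set.univ) = 1 := by
      rw [measure_iUnion₀ (fun p q hpq => aedisjoint_jumpEvent hr hP k z _ hpq)
        (fun p => (measurableSet_jumpEvent _ _ _ _ MeasurableSet.univ).nullMeasurableSet)]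
      simp only [jumpMeasure_jumpEvent hr hP _ _ _ _ MeasurableSet.univ, measure_univ, mul_one]
      rw [ENNReal.tsum_prod', ENNReal.tsum_comm]
      simp only [tsum_poissonWeight_mul hr hP k.cast_nonneg]
      rw [tsum_fintype, ← ENNReal.ofReal_sum_of_nonneg fun w _ =>
        exp_uniformized_nonneg hr hP k.cast_nonneg z w, sum_row_exp (sum_row_uniformized hP),
        ENNReal.ofReal_one]
    have h2 := (prob_compl_eq_zero_iff₀ (NullMeasurableSet.iUnion fun p : ℕ × T =>
      (measurableSet_jumpEvent p.1 (k : ℝ) z p.2 MeasurableSet.univ).nullMeasurableSet)).2 h1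
    filter_upwards [measure_eq_zero_iff_ae_notMem.1 h2] with ω hω
    simp only [Set.mem_compl_iff, not_not, Set.mem_iUnion] at hω
    obtain ⟨p, hp⟩ := hω
    exact ⟨p.1 + 1, hp.2.1⟩
  filter_upwards [ae_clock_pos hr hP, ae_all_iff.2 key] with ω h1 h2
  refine ⟨h1, fun t => ?_⟩
  obtain ⟨k, hk⟩ := exists_nat_gt t
  obtain ⟨n, hn⟩ := h2 k
  exact ⟨n, hk.trans hn⟩

/-- The Markov property at a fixed time: the state at time `t` is distributed according to the
semigroup, and the future clocks are independent of it. -/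
lemma jumpMeasure_jumpProcess [Nonempty T] (hr : 0 < r) (hP : P ∈ Matrix.rowStochastic ℝ T)
    {t : ℝ} (ht : 0 ≤ t) (z z' : T) {B : Set (ℕ → ℝ × (T → T))} (hB : MeasurableSet B) :
    jumpMeasure r P {ω | jumpProcess t ω z = z' ∧ jumpFuture t ω ∈ B} =
      ENNReal.ofReal (NormedSpace.exp (t • (r • (P - 1))) z z') * jumpMeasure r P B := by
  have h1 : {ω | jumpProcess t ω z = z' ∧ jumpFuture t ω ∈ B} =ᵐ[jumpMeasure r P]
      ⋃ n, jumpEvent n t z z' B := by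
    filter_upwards [ae_isRegularClock hr hP] with ω hω
    refine propext ?_
    change (jumpProcess t ω z = z' ∧ jumpFuture t ω ∈ B) ↔ ω ∈ ⋃ n, jumpEvent n t z z' B
    rw [Set.mem_iUnion]
    constructor
    · rintro ⟨h2, h3⟩
      obtain ⟨h4, h5⟩ := (hω.jumpCount_eq_iff ht _).1 rfl
      exact ⟨_, h4, h5, h2, h3⟩
    · rintro ⟨n, h2, h3, h4, h5⟩
      have := (hω.jumpCount_eq_iff ht n).2 ⟨h2, h3⟩
      rw [jumpProcess, jumpFuture, this]
      exact ⟨h4, h5⟩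
  rw [measure_congr h1, measure_iUnion₀ (fun n m hnm => aedisjoint_jumpEvent hr hP t z B
      (p := (n, z')) (q := (m, z')) fun h => hnm (congrArg Prod.fst h))
    (fun n => (measurableSet_jumpEvent _ _ _ _ hB).nullMeasurableSet)]
  simp only [jumpMeasure_jumpEvent hr hP _ _ _ _ hB]
  rw [ENNReal.tsum_mul_right, tsum_poissonWeight_mul hr hP ht]

lemma jumpMeasure_jumpFuture [Nonempty T] (hr : 0 < r) (hP : P ∈ Matrix.rowStochastic ℝ T)
    {t : ℝ} (ht : 0 ≤ t) (z : T) {D : T → Set (ℕ → ℝ × (T → T))} (hD : ∀ v, MeasurableSet (D v)) :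
    jumpMeasure r P {ω | jumpFuture t ω ∈ D (jumpProcess t ω z)} =
      ∑ v, ENNReal.ofReal (NormedSpace.exp (t • (r • (P - 1))) z v) * jumpMeasure r P (D v) := by
  have h1 : {ω | jumpFuture t ω ∈ D (jumpProcess t ω z)} =
      ⋃ v, {ω | jumpProcess t ω z = v ∧ jumpFuture t ω ∈ D v} := by
    ext ω
    simp
  rw [h1, measure_iUnion, tsum_fintype]
  · exact Finset.sum_congr rfl fun v _ => jumpMeasure_jumpProcess hr hP ht z v (hD v)
  · intro v w hvw
    refine Set.disjoint_left.2 fun ω h2 h3 => hvw ?_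
    rw [← h2.1, h3.1]
  · intro v
    exact (measurable_jumpProcess t z (measurableSet_singleton v)).inter
      (measurable_jumpFuture t (hD v))

lemma measurableSet_forall_mem {Ω S : Type*} [MeasurableSpace Ω] [MeasurableSpace S]
    [DiscreteMeasurableSpace S] {X : ℝ≥0 → Ω → S} (hX : ∀ t, Measurable (X t)) (J : Finset ℝ≥0)
    (C : ℝ≥0 → Set S) : MeasurableSet {ω | ∀ i ∈ J, X i ω ∈ C i} := by
  have : {ω | ∀ i ∈ J, X i ω ∈ C i} = ⋂ i ∈ J, X i ⁻¹' C i := by ext; simp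
  exact this ▸ Finset.measurableSet_biInter J fun i _ => hX i .of_discrete

/-- The finite-dimensional Markov property of the jump process that starts in `z` at time `a`. The
proof peels off the smallest observation time. -/
theorem jumpMeasure_markov [Nonempty T] (hr : 0 < r) (hP : P ∈ Matrix.rowStochastic ℝ T)
    (C : ℝ≥0 → Set T) (s t : ℝ≥0) (w z' : T) (J : Finset ℝ≥0) (hJ : ∀ i ∈ J, i ≤ s)
    (a : ℝ≥0) (ha : ∀ i ∈ J, a ≤ i) (has : a ≤ s) (z : T) :
    jumpMeasure r P {ω | (∀ i ∈ J, jumpProcess ((i : ℝ) - a) ω z ∈ C i) ∧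
        jumpProcess ((s : ℝ) - a) ω z = w ∧ jumpProcess ((s : ℝ) + t - a) ω z = z'} =
      jumpMeasure r P {ω | (∀ i ∈ J, jumpProcess ((i : ℝ) - a) ω z ∈ C i) ∧
        jumpProcess ((s : ℝ) - a) ω z = w} *
      ENNReal.ofReal (NormedSpace.exp ((t : ℝ) • (r • (P - 1))) w z') := by
  have := isProbabilityMeasure_jumpMeasure hr hP
  induction J using Finset.induction_on_min generalizing a z with
  | empty =>
    have hsa : (0 : ℝ) ≤ (s : ℝ) - a := sub_nonneg.2 (NNReal.coe_le_coe.2 has)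
    have h1 : {ω : ℕ → ℝ × (T → T) |
        (∀ i ∈ (∅ : Finset ℝ≥0), jumpProcess ((i : ℝ) - a) ω z ∈ C i) ∧
        jumpProcess ((s : ℝ) - a) ω z = w ∧ jumpProcess ((s : ℝ) + t - a) ω z = z'}
        =ᵐ[jumpMeasure r P]
        {ω | jumpProcess ((s : ℝ) - a) ω z = w ∧
          jumpFuture ((s : ℝ) - a) ω ∈ {ω | jumpProcess (t : ℝ) ω w = z'}} := by
      filter_upwards [ae_isRegularClock hr hP] with ω hω
      refine propext ?_
      change (_ ∧ _ ∧ _) ↔ (_ ∧ jumpProcess (t : ℝ) (jumpFuture ((s : ℝ) - a) ω) w = z')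
      have h2 := hω.jumpProcess_add hsa t.2 z
      rw [show (s : ℝ) - a + (t : ℝ≥0).1 = s + t - a by rw [NNReal.val_eq_coe]; ring] at h2
      rw [h2]
      constructor
      · rintro ⟨-, h3, h4⟩; exact ⟨h3, by rwa [h3] at h4⟩
      · rintro ⟨h3, h4⟩; exact ⟨by simp, h3, by rwa [h3]⟩
    have h3 : ∀ u : ℝ, 0 ≤ u → ∀ x y : T, jumpMeasure r P {ω | jumpProcess u ω x = y} =
        ENNReal.ofReal (NormedSpace.exp (u • (r • (P - 1))) x y) := by
      intro u hu x y
      have := jumpMeasure_jumpProcess hr hP hu x y MeasurableSet.univ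
      simpa using this
    have hB : MeasurableSet {ω : ℕ → ℝ × (T → T) | jumpProcess (t : ℝ) ω w = z'} :=
      measurable_jumpProcess (t : ℝ) w (measurableSet_singleton z')
    rw [measure_congr h1, jumpMeasure_jumpProcess hr hP hsa z w hB, h3 (t : ℝ) t.coe_nonneg]
    simp only [Finset.notMem_empty, false_imp_iff, imp_true_iff, true_and]
    rw [h3 _ hsa]
  | insert m J hm ih =>
    have hJs : ∀ i ∈ J, i ≤ s := fun i hi => hJ i (Finset.mem_insert_of_mem hi)
    have ham : a ≤ m := ha m (Finset.mem_insert_self _ _)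
    have hms : m ≤ s := hJ m (Finset.mem_insert_self _ _)
    have hma : (0 : ℝ) ≤ (m : ℝ) - a := sub_nonneg.2 (NNReal.coe_le_coe.2 ham)
    have hcyl : ∀ v : T, MeasurableSet {ω : ℕ → ℝ × (T → T) |
        ∀ i ∈ J, jumpProcess ((i : ℝ) - m) ω v ∈ C i} := fun v =>
      measurableSet_forall_mem (fun i => measurable_jumpProcess ((i : ℝ) - m) v) J C
    have hsing : ∀ (u : ℝ) (v y : T), MeasurableSet {ω : ℕ → ℝ × (T → T) | jumpProcess u ω v = y} :=
      fun u v y => measurable_jumpProcess u v (measurableSet_singleton y)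
    have hflow : ∀ᵐ ω ∂(jumpMeasure r P), ∀ i : ℝ, (m : ℝ) ≤ i → jumpProcess (i - a) ω z =
        jumpProcess (i - m) (jumpFuture ((m : ℝ) - a) ω) (jumpProcess ((m : ℝ) - a) ω z) := by
      filter_upwards [ae_isRegularClock hr hP] with ω hω i hi
      rw [← hω.jumpProcess_add hma (sub_nonneg.2 hi) z]
      congr 1
      ring
    set D : T → Set (ℕ → ℝ × (T → T)) := fun v => {ω | v ∈ C m ∧
      (∀ i ∈ J, jumpProcess ((i : ℝ) - m) ω v ∈ C i) ∧ jumpProcess ((s : ℝ) - m) ω v = w ∧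
        jumpProcess ((s : ℝ) + t - m) ω v = z'} with hD
    set D' : T → Set (ℕ → ℝ × (T → T)) := fun v => {ω | v ∈ C m ∧
      (∀ i ∈ J, jumpProcess ((i : ℝ) - m) ω v ∈ C i) ∧ jumpProcess ((s : ℝ) - m) ω v = w} with hD'
    have hDm : ∀ v, MeasurableSet (D v) := fun v =>
      (MeasurableSet.const _).inter ((hcyl v).inter ((hsing _ v w).inter (hsing _ v z')))
    have hDm' : ∀ v, MeasurableSet (D' v) := fun v =>
      (MeasurableSet.const _).inter ((hcyl v).inter (hsing _ v w))
    have e1 : {ω : ℕ → ℝ × (T → T) | (∀ i ∈ insert m J, jumpProcess ((i : ℝ) - a) ω z ∈ C i) ∧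
        jumpProcess ((s : ℝ) - a) ω z = w ∧ jumpProcess ((s : ℝ) + t - a) ω z = z'}
        =ᵐ[jumpMeasure r P]
        {ω | jumpFuture ((m : ℝ) - a) ω ∈ D (jumpProcess ((m : ℝ) - a) ω z)} := by
      filter_upwards [hflow] with ω hω
      refine propext ?_
      change ((∀ i ∈ insert m J, jumpProcess ((i : ℝ) - a) ω z ∈ C i) ∧
        jumpProcess ((s : ℝ) - a) ω z = w ∧ jumpProcess ((s : ℝ) + t - a) ω z = z') ↔
          (_ ∧ _ ∧ _ ∧ _)
      rw [Finset.forall_mem_insert, hω s (NNReal.coe_le_coe.2 hms),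
        hω (s + t) (le_add_of_le_of_nonneg (NNReal.coe_le_coe.2 hms) t.2), and_assoc]
      refine and_congr_right fun _ => and_congr_left' (forall₂_congr fun i hi => ?_)
      rw [hω i (NNReal.coe_le_coe.2 (hm i hi).le)]
    have e2 : {ω : ℕ → ℝ × (T → T) | (∀ i ∈ insert m J, jumpProcess ((i : ℝ) - a) ω z ∈ C i) ∧
        jumpProcess ((s : ℝ) - a) ω z = w} =ᵐ[jumpMeasure r P]
        {ω | jumpFuture ((m : ℝ) - a) ω ∈ D' (jumpProcess ((m : ℝ) - a) ω z)} := by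
      filter_upwards [hflow] with ω hω
      refine propext ?_
      change ((∀ i ∈ insert m J, jumpProcess ((i : ℝ) - a) ω z ∈ C i) ∧
        jumpProcess ((s : ℝ) - a) ω z = w) ↔ (_ ∧ _ ∧ _)
      rw [Finset.forall_mem_insert, hω s (NNReal.coe_le_coe.2 hms), and_assoc]
      refine and_congr_right fun _ => and_congr_left' (forall₂_congr fun i hi => ?_)
      rw [hω i (NNReal.coe_le_coe.2 (hm i hi).le)]
    rw [measure_congr e1, measure_congr e2, jumpMeasure_jumpFuture hr hP hma z hDm,
      jumpMeasure_jumpFuture hr hP hma z hDm', Finset.sum_mul]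
    refine Finset.sum_congr rfl fun v _ => ?_
    rw [mul_assoc]
    congr 1
    by_cases hv : v ∈ C m
    · simp only [hD, hD', hv, true_and]
      exact ih hJs m (fun i hi => (hm i hi).le) hms v
    · simp [hD, hD', hv]

end Jump

/-! ### Conditioning on the past of a finite-state process -/

section Past

lemma measurable_pastSigma {Ω S : Type*} [MeasurableSpace S] {X : ℝ≥0 → Ω → S} {s t : ℝ≥0}
    (hst : s ≤ t) : Measurable[pastSigma X t] (X s) :=
  measurable_iff_comap_le.2 (le_iSup₂_of_le s hst le_rfl)

variable {Ω S : Type*} [mΩ : MeasurableSpace Ω] [MeasurableSpace S] {X : ℝ≥0 → Ω → S}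

lemma pastSigma_le (hX : ∀ t, Measurable (X t)) (s : ℝ≥0) : pastSigma X s ≤ mΩ :=
  iSup₂_le fun t _ => (hX t).comap_le

lemma measureReal_fiber_eq {S T : Type*} [DecidableEq S] (P : Measure Ω) (Y : Ω → T) (π : T → S)
    (A : Set Ω) (x : S) (z : T) : P.real (A ∩ {ω | π (Y ω) = x} ∩ {ω | Y ω = z}) =
      if π z = x then P.real (A ∩ {ω | Y ω = z}) else 0 := by
  split_ifs with h
  · congr 1
    ext ω
    simp only [Set.mem_inter_iff, Set.mem_ofPred_eq]
    constructor
    · rintro ⟨⟨h1, -⟩, h2⟩; exact ⟨h1, h2⟩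
    · rintro ⟨h1, h2⟩; exact ⟨⟨h1, by rw [h2, h]⟩, h2⟩
  · rw [show A ∩ {ω | π (Y ω) = x} ∩ {ω | Y ω = z} = ∅ by
      ext ω
      simp only [Set.mem_inter_iff, Set.mem_ofPred_eq, Set.mem_empty_iff_false, iff_false]
      rintro ⟨⟨-, h1⟩, h2⟩
      exact h (by rw [← h2, h1]), measureReal_empty]

lemma measurableSet_pastSigma_cylinder {Ω S : Type*} [MeasurableSpace S]
    [DiscreteMeasurableSpace S] {X : ℝ≥0 → Ω → S} (J : Finset ℝ≥0) {s : ℝ≥0} (hJ : ∀ i ∈ J, i ≤ s)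
    (C : ℝ≥0 → Set S) : MeasurableSet[pastSigma X s] {ω | ∀ i ∈ J, X i ω ∈ C i} := by
  have : {ω | ∀ i ∈ J, X i ω ∈ C i} = ⋂ i ∈ J, X i ⁻¹' C i := by ext; simp
  rw [this]
  exact Finset.measurableSet_biInter J fun i hi => measurable_pastSigma (hJ i hi) .of_discrete

variable [DiscreteMeasurableSpace S] [Fintype S] {P : Measure Ω} [IsProbabilityMeasure P]

lemma measureReal_eq_sum_fiber {Y : Ω → S} (hY : Measurable Y) {A : Set Ω} (hA : MeasurableSet A) :
    P.real A = ∑ x, P.real (A ∩ {ω | Y ω = x}) := by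
  classical
  have h1 : A = ⋃ x ∈ (Finset.univ : Finset S), A ∩ {ω | Y ω = x} := by ext; simp
  conv_lhs => rw [h1]
  refine measureReal_biUnion_finset (fun x _ y _ hxy => ?_) fun x _ =>
    hA.inter (hY (measurableSet_singleton x))
  refine Set.disjoint_left.2 fun ω h2 h3 => hxy ?_
  rw [← h2.2, h3.2]

lemma integrable_comp_of_finite {Y : Ω → S} (hY : Measurable Y) (g : S → ℝ) :
    Integrable (fun ω => g (Y ω)) P := by
  obtain ⟨C, hC⟩ := (Set.finite_range fun x => ‖g x‖).bddAbove
  exact Integrable.of_bound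
    ((Measurable.of_discrete (f := g)).comp hY).aestronglyMeasurable C
    (Eventually.of_forall fun ω => hC ⟨Y ω, rfl⟩)

lemma setIntegral_comp_of_finite {Y : Ω → S} (hY : Measurable Y) (g : S → ℝ) {A : Set Ω}
    (hA : MeasurableSet A) :
    ∫ ω in A, g (Y ω) ∂P = ∑ x, P.real (A ∩ {ω | Y ω = x}) * g x := by
  classical
  have h1 : A = ⋃ x ∈ (Finset.univ : Finset S), A ∩ {ω | Y ω = x} := by ext; simp
  have hm : ∀ x, MeasurableSet (A ∩ {ω | Y ω = x}) := fun x =>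
    hA.inter (hY (measurableSet_singleton x))
  conv_lhs => rw [h1]
  rw [integral_biUnion_finset _ (fun x _ => hm x) (fun x _ y _ hxy =>
    Set.disjoint_left.2 fun ω h2 h3 => hxy (by rw [← h2.2, h3.2]))
    fun x _ => (integrable_comp_of_finite hY g).integrableOn]
  refine Finset.sum_congr rfl fun x _ => ?_
  rw [setIntegral_congr_fun (g := fun _ => g x) (hm x) fun ω hω => by
    simp only [hω.2.out], setIntegral_const, smul_eq_mul]

/-- A conditional probability given the past can be identified on cylinder sets. -/
theorem condProb_past_eq (hX : ∀ t, Measurable (X t)) (s : ℝ≥0) {E : Set Ω}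
    (hE : MeasurableSet E) (g : S → ℝ)
    (h : ∀ (J : Finset ℝ≥0) (C : ℝ≥0 → Set S) (x : S), (∀ i ∈ J, i ≤ s) →
      P.real ({ω | ∀ i ∈ J, X i ω ∈ C i} ∩ {ω | X s ω = x} ∩ E) =
        P.real ({ω | ∀ i ∈ J, X i ω ∈ C i} ∩ {ω | X s ω = x}) * g x) :
    P⟦E | pastSigma X s⟧ =ᵐ[P] fun ω => g (X s ω) := by
  have hm := pastSigma_le hX s
  have hint : Integrable (fun ω => g (X s ω)) P := integrable_comp_of_finite (hX s) g
  have hEi : Integrable (E.indicator fun _ => (1 : ℝ)) P := (integrable_const 1).indicator hE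
  have hset : ∀ A, MeasurableSet A → ∫ ω in A, E.indicator (fun _ => (1 : ℝ)) ω ∂P =
      P.real (A ∩ E) := fun A _ => by
    rw [setIntegral_indicator hE, setIntegral_const, smul_eq_mul, mul_one]
  have hcyl : ∀ (J : Finset ℝ≥0) (C : ℝ≥0 → Set S), (∀ i ∈ J, i ≤ s) →
      ∫ ω in {ω | ∀ i ∈ J, X i ω ∈ C i}, g (X s ω) ∂P =
        ∫ ω in {ω | ∀ i ∈ J, X i ω ∈ C i}, E.indicator (fun _ => (1 : ℝ)) ω ∂P := by
    intro J C hJ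
    have hA := measurableSet_forall_mem hX J C
    rw [hset _ hA, setIntegral_comp_of_finite (hX s) g hA,
      measureReal_eq_sum_fiber (hX s) (hA.inter hE)]
    refine Finset.sum_congr rfl fun x _ => ?_
    rw [← h J C x hJ, Set.inter_right_comm]
  refine (ae_eq_condExp_of_forall_setIntegral_eq hm hEi (fun _ _ _ => hint.integrableOn) ?_
    ((Measurable.of_discrete (f := g)).comp
      (measurable_pastSigma le_rfl)).stronglyMeasurable.aestronglyMeasurable).symm
  intro A hA _
  induction A, hA using MeasurableSpace.induction_on_inter
    (generateFrom_piiUnionInter_measurableSet (fun t => MeasurableSpace.comap (X t) inferInstance)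
      (Set.Iic s)).symm
    (isPiSystem_piiUnionInter _ (fun t => @MeasurableSpace.isPiSystem_measurableSet Ω
      (MeasurableSpace.comap (X t) inferInstance)) _) with
  | empty => simp
  | basic A hA =>
    obtain ⟨J, hJ, f, hf, rfl⟩ := hA
    have hf' : ∀ i, ∃ C : Set S, i ∈ J → X i ⁻¹' C = f i := fun i => by
      by_cases hi : i ∈ J
      · obtain ⟨C, -, hC⟩ := hf i hi
        exact ⟨C, fun _ => hC⟩
      · exact ⟨∅, fun h => absurd h hi⟩
    choose C hC using hf'
    have hAe : ⋂ x ∈ J, f x = {ω | ∀ i ∈ J, X i ω ∈ C i} := by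
      ext ω
      simp only [Set.mem_iInter, Set.mem_ofPred_eq]
      exact forall₂_congr fun i hi => by rw [← hC i hi]; rfl
    rw [hAe]
    exact hcyl J C fun i hi => hJ hi
  | compl A hA ih =>
    have huniv := hcyl ∅ (fun _ => ∅) (by simp)
    simp only [Finset.notMem_empty, false_imp_iff, imp_true_iff, Set.ofPred_true,
      setIntegral_univ] at huniv
    have h1 := integral_add_compl (hm _ hA) hint
    have h2 := integral_add_compl (hm _ hA) hEi
    have := ih (measure_lt_top _ _)
    linarith
  | iUnion f hd hf ih =>
    rw [integral_iUnion (fun i => hm _ (hf i)) hd hint.integrableOn,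
      integral_iUnion (fun i => hm _ (hf i)) hd hEi.integrableOn]
    exact tsum_congr fun i => ih i (measure_lt_top _ _)

/-- The defining property of a conditional probability that is a function of a finite-valued random
variable. -/
lemma measureReal_inter_of_condProb {E : Set Ω} (hE : MeasurableSet E) {Y : Ω → S}
    (hY : Measurable Y) {g : S → ℝ} {m : MeasurableSpace Ω} (hm : m ≤ mΩ)
    (h : P⟦E | m⟧ =ᵐ[P] fun ω => g (Y ω)) {A : Set Ω} (hA : MeasurableSet[m] A) :
    P.real (A ∩ E) = ∑ x, P.real (A ∩ {ω | Y ω = x}) * g x := by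
  rw [← setIntegral_comp_of_finite (mΩ := mΩ) hY g (hm _ hA), ← setIntegral_congr_ae (hm _ hA)
    (h.mono fun _ hω _ => hω), setIntegral_condExp hm ((integrable_const 1).indicator hE) hA,
    setIntegral_indicator hE, setIntegral_const, smul_eq_mul, mul_one]

end Past

/-! ### Functions of Markov processes -/

section Functions

lemma IsMarkovProcess.measureReal_start {Ω T : Type*} [MeasurableSpace Ω] [MeasurableSpace T]
    [Fintype T] [DecidableEq T] {P : Measure Ω} [IsProbabilityMeasure P] {L : Matrix T T ℝ} {z₀ : T}
    {Z : ℝ≥0 → Ω → T} (hZ : IsMarkovProcess P L z₀ Z) (z : T) :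
    P.real {ω | Z 0 ω = z} = if z = z₀ then 1 else 0 := by
  split_ifs with h
  · subst h
    have h1 : {ω | Z 0 ω = z} =ᵐ[P] Set.univ := by
      filter_upwards [hZ.start] with ω hω
      exact propext ⟨fun _ => trivial, fun _ => hω⟩
    rw [measureReal_congr h1, probReal_univ]
  · have h1 : {ω | Z 0 ω = z} =ᵐ[P] (∅ : Set Ω) := by
      filter_upwards [hZ.start] with ω hω
      exact propext ⟨fun (h2 : Z 0 ω = z) => h (h2.symm.trans hω), fun h => h.elim⟩
    rw [measureReal_congr h1, measureReal_empty]

lemma measurableSet_pastSigma_map_cylinder {Ω S T : Type*} [MeasurableSpace T]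
    [DiscreteMeasurableSpace T] {Z : ℝ≥0 → Ω → T} (π : T → S) (J : Finset ℝ≥0) {s : ℝ≥0}
    (hJ : ∀ i ∈ J, i ≤ s) (C : ℝ≥0 → Set S) :
    MeasurableSet[pastSigma Z s] {ω | ∀ i ∈ J, π (Z i ω) ∈ C i} :=
  measurableSet_pastSigma_cylinder J hJ fun i => π ⁻¹' C i

variable {Ω S T : Type*} [mΩ : MeasurableSpace Ω] [MeasurableSpace S] [MeasurableSpace T]
  [DiscreteMeasurableSpace S] [DiscreteMeasurableSpace T] [Fintype S] [Fintype T]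
  [DecidableEq S] [DecidableEq T] {P : Measure Ω} [IsProbabilityMeasure P]
  {L : Matrix T T ℝ} {z₀ : T} {Z : ℝ≥0 → Ω → T}

lemma IsMarkovProcess.measureReal_inter (hZ : IsMarkovProcess P L z₀ Z) (s t : ℝ≥0) (z : T)
    {A : Set Ω} (hA : MeasurableSet[pastSigma Z s] A) :
    P.real (A ∩ {ω | Z (s + t) ω = z}) =
      ∑ w, P.real (A ∩ {ω | Z s ω = w}) * NormedSpace.exp ((t : ℝ) • L) w z :=
  measureReal_inter_of_condProb (hZ.measurable _ (measurableSet_singleton z)) (hZ.measurable s)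
    (g := fun w => NormedSpace.exp ((t : ℝ) • L) w z) (pastSigma_le hZ.measurable s)
    (hZ.markov s t z) hA

/-- The law of `π (Z (s + t))` on an event from the past of `Z`. -/
lemma IsMarkovProcess.measureReal_inter_map (hZ : IsMarkovProcess P L z₀ Z) (π : T → S)
    (s t : ℝ≥0) (y : S) {A : Set Ω} (hA : MeasurableSet[pastSigma Z s] A) :
    P.real (A ∩ {ω | π (Z (s + t) ω) = y}) =
      ∑ w, P.real (A ∩ {ω | Z s ω = w}) *
        (NormedSpace.exp ((t : ℝ) • L) * mapKernel π) w y := by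
  have hA' := pastSigma_le hZ.measurable s _ hA
  have hπ : ∀ u, Measurable fun ω => π (Z u ω) := fun u =>
    (Measurable.of_discrete (f := π)).comp (hZ.measurable u)
  have hB : MeasurableSet {ω | π (Z (s + t) ω) = y} := hπ _ (measurableSet_singleton y)
  rw [measureReal_eq_sum_fiber (hZ.measurable (s + t)) (hA'.inter hB)]
  simp only [measureReal_fiber_eq, hZ.measureReal_inter s t _ hA, mul_mapKernel, Finset.mul_sum,
    Finset.sum_filter]
  rw [Finset.sum_comm]
  exact Finset.sum_congr rfl fun z _ => by
    split_ifs with h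
    · rfl
    · simp

lemma isMarkovProcess_map_aux (hZ : IsMarkovProcess P L z₀ Z) (π : T → S) (G : Matrix S S ℝ)
    (h : ∀ (s t : ℝ≥0) (J : Finset ℝ≥0) (C : ℝ≥0 → Set S) (x y : S), (∀ i ∈ J, i ≤ s) →
      P.real ({ω | ∀ i ∈ J, π (Z i ω) ∈ C i} ∩ {ω | π (Z s ω) = x} ∩
        {ω | π (Z (s + t) ω) = y}) =
        P.real ({ω | ∀ i ∈ J, π (Z i ω) ∈ C i} ∩ {ω | π (Z s ω) = x}) *
          NormedSpace.exp ((t : ℝ) • G) x y) :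
    IsMarkovProcess P G (π z₀) fun t ω => π (Z t ω) where
  measurable t := (Measurable.of_discrete (f := π)).comp (hZ.measurable t)
  start := hZ.start.mono fun ω hω => congrArg π hω
  right_continuous := hZ.right_continuous.mono fun ω hω t =>
    (hω t).mono fun s hs => congrArg π hs
  left_limits := hZ.left_limits.mono fun ω hω t => by
    obtain ⟨l, hl⟩ := hω t
    exact ⟨π l, hl.mono fun s hs => congrArg π hs⟩
  markov s t y := condProb_past_eq
    (fun t => (Measurable.of_discrete (f := π)).comp (hZ.measurable t)) s
    ((Measurable.of_discrete (f := π)).comp (hZ.measurable (s + t)) (measurableSet_singleton y))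
    (fun x => NormedSpace.exp ((t : ℝ) • G) x y) fun J C x hJ => h s t J C x y hJ

/-- Dynkin's criterion: an autonomous function of a Markov process is a Markov process. -/
theorem IsMarkovProcess.map_of_autonomous (hZ : IsMarkovProcess P L z₀ Z) (π : T → S)
    {G : Matrix S S ℝ} (hG : L * mapKernel π = mapKernel π * G) :
    IsMarkovProcess P G (π z₀) fun t ω => π (Z t ω) := by
  refine isMarkovProcess_map_aux hZ π G fun s t J C x y hJ => ?_
  have hA := measurableSet_pastSigma_map_cylinder (Z := Z) π J hJ C
  have hA1 : MeasurableSet[pastSigma Z s] ({ω | ∀ i ∈ J, π (Z i ω) ∈ C i} ∩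
      {ω | π (Z s ω) = x}) :=
    hA.inter ((Measurable.of_discrete (f := π)).comp (measurable_pastSigma le_rfl)
      (measurableSet_singleton x))
  have h1 := mul_exp_smul_of_intertwining hG.symm (t : ℝ)
  rw [hZ.measureReal_inter_map π s t y hA1, measureReal_eq_sum_fiber (hZ.measurable s)
    (pastSigma_le hZ.measurable s _ hA1), Finset.sum_mul, ← h1]
  refine Finset.sum_congr rfl fun z _ => ?_
  rw [mapKernel_mul, measureReal_fiber_eq]
  split_ifs with h
  · rw [h]
  · simp

end Functions

/-! ### The Rogers–Pitman criterion -/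

/-- The kernel `Λ` from `S` to `T` is concentrated on the fibres of `π : T → S` and charges only
`z₀` in the fibre of `z₀`: it can serve as the conditional law of a Markov process on `T` started
in `z₀`, given its image under `π`. -/
structure IsFibreKernel {S T : Type*} [Fintype T] [DecidableEq T] (π : T → S) (Λ : Matrix S T ℝ)
    (z₀ : T) : Prop where
  eq_zero : ∀ x z, π z ≠ x → Λ x z = 0
  sum_row : ∀ x, ∑ z, Λ x z = 1
  start : ∀ z, Λ (π z₀) z = if z = z₀ then 1 else 0

section FibreKernel

variable {S T : Type*} [Fintype T] [DecidableEq T] {π : T → S} {Λ : Matrix S T ℝ} {z₀ : T}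

lemma IsFibreKernel.mul_mapKernel_eq_one [DecidableEq S] (hΛ : IsFibreKernel π Λ z₀) :
    Λ * mapKernel π = 1 := by
  ext x y
  rw [mul_mapKernel, Matrix.one_apply]
  split_ifs with h
  · subst h
    rw [← hΛ.sum_row x, Finset.sum_filter]
    refine Finset.sum_congr rfl fun z _ => ?_
    split_ifs with h
    · rfl
    · exact (hΛ.eq_zero x z h).symm
  · refine Finset.sum_eq_zero fun z hz => hΛ.eq_zero x z ?_
    rw [(Finset.mem_filter.1 hz).2]
    exact Ne.symm h

lemma IsFibreKernel.vecMul_apply [Fintype S] (hΛ : IsFibreKernel π Λ z₀) (c : S → ℝ) (z : T) :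
    (c ᵥ* Λ) z = c (π z) * Λ (π z) z :=
  Finset.sum_eq_single (π z)
    (fun x _ hx => mul_eq_zero_of_right _ (hΛ.eq_zero x z (Ne.symm hx)))
    fun h => absurd (Finset.mem_univ _) h

end FibreKernel

section RogersPitman

variable {Ω S T : Type*} [mΩ : MeasurableSpace Ω] [MeasurableSpace T]
  [DiscreteMeasurableSpace T] [Fintype S] [Fintype T] [DecidableEq S] [DecidableEq T]
  {P : Measure Ω} [IsProbabilityMeasure P] {L : Matrix T T ℝ} {z₀ : T} {Z : ℝ≥0 → Ω → T}
  {π : T → S} {Λ : Matrix S T ℝ} {G : Matrix S S ℝ}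

/-- If `Λ` intertwines `L` with `G`, then on every event that constrains `π (Z i)` at finitely many
times `i ≤ s`, the sub-probability law of `Z s` is a mixture of rows of `Λ`. Observation times are
added in increasing order: restricting a mixture to a set of fibres only changes the weights `c`,
and letting `Z` run multiplies them by the semigroup of `G`. -/
theorem IsMarkovProcess.exists_measureReal_cylinder (hZ : IsMarkovProcess P L z₀ Z)
    (hΛ : IsFibreKernel π Λ z₀) (hG : Λ * L = G * Λ) (C : ℝ≥0 → Set S) (J : Finset ℝ≥0) (s : ℝ≥0)
    (hJ : ∀ i ∈ J, i ≤ s) :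
    ∃ c : S → ℝ, ∀ z, P.real ({ω | ∀ i ∈ J, π (Z i ω) ∈ C i} ∩ {ω | Z s ω = z}) =
      (c ᵥ* Λ) z := by
  classical
  induction J using Finset.induction_on_max generalizing s with
  | empty =>
    refine ⟨NormedSpace.exp ((s : ℝ) • G) (π z₀), fun z => ?_⟩
    have h1 := hZ.measureReal_inter 0 s z MeasurableSet.univ
    simp only [Set.univ_inter, zero_add, hZ.measureReal_start, ite_mul, one_mul, zero_mul,
      Finset.sum_ite_eq', Finset.mem_univ, if_true] at h1
    simp only [Finset.notMem_empty, false_imp_iff, imp_true_iff, Set.ofPred_true, Set.univ_inter,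
      h1]
    have h2 := congrFun (congrFun (mul_exp_smul_of_intertwining hG (s : ℝ)) (π z₀)) z
    simp only [Matrix.mul_apply, hΛ.start, ite_mul, one_mul, zero_mul, Finset.sum_ite_eq',
      Finset.mem_univ, if_true] at h2
    rw [h2]
    rfl
  | insert m J hm ih =>
    obtain ⟨c, hc⟩ := ih m fun i hi => (hm i hi).le
    refine ⟨(fun x => if x ∈ C m then c x else 0) ᵥ*
      NormedSpace.exp (((s - m : ℝ≥0) : ℝ) • G), fun z => ?_⟩
    have hms : m ≤ s := hJ m (Finset.mem_insert_self _ _)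
    have hA : MeasurableSet[pastSigma Z m] {ω | ∀ i ∈ insert m J, π (Z i ω) ∈ C i} :=
      measurableSet_pastSigma_map_cylinder π _ (fun i hi => by
        rcases Finset.mem_insert.1 hi with rfl | hi
        · exact le_rfl
        · exact (hm i hi).le) C
    have h1 := hZ.measureReal_inter m (s - m) z hA
    rw [add_tsub_cancel_of_le hms] at h1
    have h2 : ∀ w, P.real ({ω | ∀ i ∈ insert m J, π (Z i ω) ∈ C i} ∩ {ω | Z m ω = w}) =
        ((fun x => if x ∈ C m then c x else 0) ᵥ* Λ) w := by
      intro w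
      rw [hΛ.vecMul_apply]
      have h3 := hc w
      rw [hΛ.vecMul_apply] at h3
      split_ifs with hw
      · rw [← h3]
        congr 1
        ext ω
        simp only [Finset.forall_mem_insert, Set.mem_inter_iff, Set.mem_ofPred_eq]
        constructor
        · rintro ⟨⟨-, h4⟩, h5⟩; exact ⟨h4, h5⟩
        · rintro ⟨h4, h5⟩; exact ⟨⟨by rwa [h5], h4⟩, h5⟩
      · rw [zero_mul, show {ω | ∀ i ∈ insert m J, π (Z i ω) ∈ C i} ∩ {ω | Z m ω = w} = ∅ by
          ext ω
          simp only [Finset.forall_mem_insert, Set.mem_inter_iff, Set.mem_ofPred_eq,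
            Set.mem_empty_iff_false, iff_false]
          rintro ⟨⟨h4, -⟩, h5⟩
          exact hw (by rwa [← h5]), measureReal_empty]
    rw [h1, Matrix.vecMul_vecMul, ← mul_exp_smul_of_intertwining hG, ← Matrix.vecMul_vecMul]
    simp only [h2]
    rfl

lemma IsMarkovProcess.measureReal_fibre (hZ : IsMarkovProcess P L z₀ Z)
    (hΛ : IsFibreKernel π Λ z₀) (hG : Λ * L = G * Λ) (C : ℝ≥0 → Set S) (J : Finset ℝ≥0) (s : ℝ≥0)
    (hJ : ∀ i ∈ J, i ≤ s) (x : S) (z : T) :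
    P.real ({ω | ∀ i ∈ J, π (Z i ω) ∈ C i} ∩ {ω | π (Z s ω) = x} ∩ {ω | Z s ω = z}) =
      P.real ({ω | ∀ i ∈ J, π (Z i ω) ∈ C i} ∩ {ω | π (Z s ω) = x}) * Λ x z := by
  obtain ⟨c, hc⟩ := hZ.exists_measureReal_cylinder hΛ hG C J s hJ
  have h1 : ∀ z, P.real ({ω | ∀ i ∈ J, π (Z i ω) ∈ C i} ∩ {ω | π (Z s ω) = x} ∩
      {ω | Z s ω = z}) = c x * Λ x z := by
    intro z
    rw [measureReal_fiber_eq, hc, hΛ.vecMul_apply]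
    split_ifs with h
    · rw [h]
    · rw [hΛ.eq_zero x z h, mul_zero]
  have hA : MeasurableSet ({ω | ∀ i ∈ J, π (Z i ω) ∈ C i} ∩ {ω | π (Z s ω) = x}) :=
    (pastSigma_le hZ.measurable s _ (measurableSet_pastSigma_map_cylinder π J hJ C)).inter
      (hZ.measurable s (.of_discrete (s := π ⁻¹' {x})))
  rw [measureReal_eq_sum_fiber (hZ.measurable s) hA, h1]
  simp only [h1, ← Finset.mul_sum, hΛ.sum_row, mul_one]

variable [MeasurableSpace S] [DiscreteMeasurableSpace S]

/-- The Rogers–Pitman criterion: if `Λ` intertwines `L` with `G`, then `π ∘ Z` is a Markov process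
with generator `G`. -/
theorem IsMarkovProcess.map_of_intertwining (hZ : IsMarkovProcess P L z₀ Z)
    (hΛ : IsFibreKernel π Λ z₀) (hG : Λ * L = G * Λ) :
    IsMarkovProcess P G (π z₀) fun t ω => π (Z t ω) := by
  refine isMarkovProcess_map_aux hZ π G fun s t J C x y hJ => ?_
  have hA : MeasurableSet[pastSigma Z s] ({ω | ∀ i ∈ J, π (Z i ω) ∈ C i} ∩
      {ω | π (Z s ω) = x}) :=
    (measurableSet_pastSigma_map_cylinder (Z := Z) π J hJ C).inter
      ((Measurable.of_discrete (f := π)).comp (measurable_pastSigma le_rfl)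
        (measurableSet_singleton x))
  have h1 : Λ * (NormedSpace.exp ((t : ℝ) • L) * mapKernel π) = NormedSpace.exp ((t : ℝ) • G) := by
    rw [← Matrix.mul_assoc, mul_exp_smul_of_intertwining hG, Matrix.mul_assoc,
      hΛ.mul_mapKernel_eq_one, Matrix.mul_one]
  rw [hZ.measureReal_inter_map π s t y hA, ← h1, Matrix.mul_apply, Finset.mul_sum]
  refine Finset.sum_congr rfl fun z _ => ?_
  rw [hZ.measureReal_fibre hΛ hG C J s hJ, mul_assoc]

/-- In the Rogers–Pitman criterion, `Λ` is the conditional law of `Z t` given the past of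
`π ∘ Z`. -/
theorem IsMarkovProcess.condProb_of_intertwining {R : Type*} [DecidableEq R]
    (hZ : IsMarkovProcess P L z₀ Z)
    (hΛ : IsFibreKernel π Λ z₀) (hG : Λ * L = G * Λ) (f : T → R) (t : ℝ≥0) (y : R) :
    P⟦{ω | f (Z t ω) = y} | pastSigma (fun s ω => π (Z s ω)) t⟧ =ᵐ[P]
      fun ω => (Λ * mapKernel f) (π (Z t ω)) y := by
  have hE : MeasurableSet {ω | f (Z t ω) = y} :=
    hZ.measurable t (.of_discrete (s := f ⁻¹' {y}))
  have hπ : ∀ s, Measurable fun ω => π (Z s ω) := fun s =>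
    (Measurable.of_discrete (f := π)).comp (hZ.measurable s)
  refine condProb_past_eq hπ t hE (fun x => (Λ * mapKernel f) x y) fun J C x hJ => ?_
  have hA : MeasurableSet ({ω | ∀ i ∈ J, π (Z i ω) ∈ C i} ∩ {ω | π (Z t ω) = x}) :=
    (measurableSet_forall_mem hπ J C).inter (hπ t (measurableSet_singleton x))
  rw [measureReal_eq_sum_fiber (hZ.measurable t) (hA.inter hE), mul_mapKernel, Finset.mul_sum,
    Finset.sum_filter]
  refine Finset.sum_congr rfl fun z _ => ?_
  rw [measureReal_fiber_eq, hZ.measureReal_fibre hΛ hG C J t hJ]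

end RogersPitman

/-! ### The jump process as a Markov process -/

theorem isMarkovProcess_jumpProcess {T : Type*} [Fintype T] [DecidableEq T] [MeasurableSpace T]
    [DiscreteMeasurableSpace T] {r : ℝ} {P : Matrix T T ℝ} (hr : 0 < r)
    (hP : P ∈ Matrix.rowStochastic ℝ T) (z₀ : T) :
    IsMarkovProcess (jumpMeasure r P) (r • (P - 1)) z₀
      fun (t : ℝ≥0) ω => jumpProcess (t : ℝ) ω z₀ := by
  have : Nonempty T := ⟨z₀⟩
  have := isProbabilityMeasure_jumpMeasure hr hP
  have hreg := ae_isRegularClock hr hP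
  refine ⟨fun t => measurable_jumpProcess t z₀, ?_, ?_, ?_, fun s t y => ?_⟩
  · filter_upwards [hreg] with ω hω
    have : jumpCount ((0 : ℝ≥0) : ℝ) ω = 0 :=
      (hω.jumpCount_eq_iff (t := ((0 : ℝ≥0) : ℝ)) le_rfl 0).2
        ⟨(jumpTime_zero ω).le, by simpa [jumpTime_succ, jumpTime_zero] using hω.pos 0⟩
    rw [jumpProcess, this]
    rfl
  · filter_upwards [hreg] with ω hω t using hω.eventually_right z₀ t
  · filter_upwards [hreg] with ω hω t using hω.eventually_left z₀ t
  · refine condProb_past_eq (fun t => measurable_jumpProcess t z₀) s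
      (measurable_jumpProcess _ z₀ (measurableSet_singleton y))
      (fun x => NormedSpace.exp ((t : ℝ) • (r • (P - 1))) x y) fun J C x hJ => ?_
    have h1 := congrArg ENNReal.toReal
      (jumpMeasure_markov hr hP C s t x y J hJ 0 (fun _ _ => zero_le) zero_le z₀)
    have h2 := ENNReal.toReal_ofReal (exp_uniformized_nonneg hr hP t.2 x y)
    simp only [NNReal.coe_zero, sub_zero, ENNReal.toReal_mul] at h1
    rw [Set.inter_assoc]
    exact h1.trans (congrArg _ h2)

/-! ### The intertwined coupling -/

section Uniformization

lemma smul_uniformization_sub_one {S : Type*} [DecidableEq S] (G : Matrix S S ℝ) {r : ℝ}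
    (hr : 0 < r) : r • (1 + r⁻¹ • G - 1) = G := by
  rw [add_sub_cancel_left, smul_smul, mul_inv_cancel₀ hr.ne', one_smul]

variable {S T : Type*} [Fintype S] [Fintype T] [DecidableEq S] [DecidableEq T]

lemma uniformization_mem_rowStochastic {G : Matrix S S ℝ} (hoff : ∀ x y, x ≠ y → 0 ≤ G x y)
    (hrow : ∀ x, ∑ y, G x y = 0) {r : ℝ} (hr : 0 < r) (hdiag : ∀ x, -G x x ≤ r) :
    1 + r⁻¹ • G ∈ Matrix.rowStochastic ℝ S := by
  rw [Matrix.mem_rowStochastic_iff_sum]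
  refine ⟨fun x y => ?_, fun x => ?_⟩
  · rw [Matrix.add_apply, Matrix.smul_apply, Matrix.one_apply, smul_eq_mul]
    split_ifs with h
    · subst h
      have h1 : r⁻¹ * -G x x ≤ 1 := by
        rw [inv_mul_le_iff₀ hr, mul_one]
        exact hdiag x
      linarith
    · have := mul_nonneg (inv_nonneg.2 hr.le) (hoff x y h)
      linarith
  · simp [Finset.sum_add_distrib, ← Finset.mul_sum, hrow, Matrix.one_apply]

lemma mul_uniformization {Λ : Matrix S T ℝ} {L : Matrix T T ℝ} {G : Matrix S S ℝ}
    (h : Λ * L = G * Λ) (r : ℝ) : Λ * (1 + r • L) = (1 + r • G) * Λ := by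
  simp [Matrix.mul_add, Matrix.add_mul, h]

lemma mul_smul_sub_one {Λ : Matrix S T ℝ} {Q : Matrix T T ℝ} {R : Matrix S S ℝ}
    (h : Λ * Q = R * Λ) (r : ℝ) : Λ * (r • (Q - 1)) = (r • (R - 1)) * Λ := by
  simp [Matrix.mul_sub, Matrix.sub_mul, h]

lemma isFibreKernel_graphKernel {K : Matrix S T ℝ} (hK : ∀ x, ∑ y, K x y = 1) {x₀ : S} {y₀ : T}
    (h₀ : ∀ y, K x₀ y = if y = y₀ then 1 else 0) :
    IsFibreKernel Prod.fst (graphKernel K) (x₀, y₀) where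
  eq_zero x z h := if_neg h
  sum_row x := by simp [graphKernel, Fintype.sum_prod_type, hK]
  start z := by
    obtain ⟨x, y⟩ := z
    simp only [graphKernel, Matrix.of_apply, Prod.mk.injEq, h₀]
    split_ifs <;> simp_all

lemma graphKernel_mul_mapKernel_snd (K : Matrix S T ℝ) :
    graphKernel K * (mapKernel Prod.snd : Matrix (S × T) T ℝ) = K := by
  ext x y
  rw [mul_mapKernel, Finset.sum_filter, Fintype.sum_prod_type]
  simp [graphKernel]

end Uniformization

/-- Conservative generators intertwined by stochastic kernels are realized by a coupling, obtained
by uniformizing at a common rate `r`. The chain `(X⁺, X)` jumps according to the coupling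
`P₂` of the uniformized chains, and is itself intertwined with `X⁻` by the kernel that applies `Km`
to the second coordinate. -/
theorem exists_isIntertwinedCoupling {N : ℕ}
    {Gm G Gp Km Kp : Matrix (Fin (N + 1)) (Fin (N + 1)) ℝ}
    (hGm : ∀ x y, x ≠ y → 0 ≤ Gm x y) (hGm' : ∀ x, ∑ y, Gm x y = 0)
    (hG : ∀ x y, x ≠ y → 0 ≤ G x y) (hG' : ∀ x, ∑ y, G x y = 0)
    (hGp : ∀ x y, x ≠ y → 0 ≤ Gp x y) (hGp' : ∀ x, ∑ y, Gp x y = 0)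
    (hKm : Km ∈ Matrix.rowStochastic ℝ (Fin (N + 1)))
    (hKp : Kp ∈ Matrix.rowStochastic ℝ (Fin (N + 1)))
    (hKm₀ : ∀ y, Km 0 y = if y = 0 then 1 else 0) (hKp₀ : ∀ y, Kp 0 y = if y = 0 then 1 else 0)
    (hp : Kp * G = Gp * Kp) (hm : G * Km = Km * Gm) :
    ∃ (Ω : Type) (_ : MeasurableSpace Ω) (P : Measure Ω) (_ : IsProbabilityMeasure P)
      (Xm X Xp : ℝ≥0 → Ω → Fin (N + 1)), IsIntertwinedCoupling P Gm G Gp Km Kp Xm X Xp := by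
  obtain ⟨r, hr, hrm, hr', hrp⟩ : ∃ r : ℝ, 0 < r ∧ (∀ x, -Gm x x ≤ r) ∧ (∀ x, -G x x ≤ r) ∧
      ∀ x, -Gp x x ≤ r := by
    have hle : ∀ (A : Matrix (Fin (N + 1)) (Fin (N + 1)) ℝ) x, -A x x ≤ ∑ y, |A y y| := fun A x =>
      (neg_le_abs _).trans (Finset.single_le_sum (f := fun y => |A y y|)
        (fun _ _ => abs_nonneg _) (Finset.mem_univ x))
    have hpos : ∀ A : Matrix (Fin (N + 1)) (Fin (N + 1)) ℝ, 0 ≤ ∑ y, |A y y| := fun A =>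
      Finset.sum_nonneg fun _ _ => abs_nonneg _
    have h1 := hpos Gm
    have h2 := hpos G
    have h3 := hpos Gp
    refine ⟨1 + ∑ y, |Gm y y| + ∑ y, |G y y| + ∑ y, |Gp y y|, by linarith, fun x => ?_,
      fun x => ?_, fun x => ?_⟩
    · linarith [hle Gm x]
    · linarith [hle G x]
    · linarith [hle Gp x]
  set Qm := 1 + r⁻¹ • Gm with hQm
  set Q := 1 + r⁻¹ • G with hQ
  set Qp := 1 + r⁻¹ • Gp with hQp
  have sQm : Qm ∈ Matrix.rowStochastic ℝ (Fin (N + 1)) :=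
    uniformization_mem_rowStochastic hGm hGm' hr hrm
  have sQ : Q ∈ Matrix.rowStochastic ℝ (Fin (N + 1)) :=
    uniformization_mem_rowStochastic hG hG' hr hr'
  have sQp : Qp ∈ Matrix.rowStochastic ℝ (Fin (N + 1)) :=
    uniformization_mem_rowStochastic hGp hGp' hr hrp
  have hpQ : Kp * Q = Qp * Kp := mul_uniformization hp _
  have hmQ : Km * Qm = Q * Km := mul_uniformization hm.symm _
  have hrow := fun {K : Matrix (Fin (N + 1)) (Fin (N + 1)) ℝ}
    (hK : K ∈ Matrix.rowStochastic ℝ (Fin (N + 1))) => (Matrix.mem_rowStochastic_iff_sum.1 hK)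
  set P₂ := coupledMatrix Qp Q Kp with hP₂
  have sP₂ : P₂ ∈ Matrix.rowStochastic ℝ _ :=
    coupledMatrix_mem_rowStochastic hpQ sQp sQ (hrow hKp).1
  set K₂ : Matrix (Fin (N + 1) × Fin (N + 1)) (Fin (N + 1)) ℝ :=
    (mapKernel Prod.snd : Matrix (Fin (N + 1) × Fin (N + 1)) (Fin (N + 1)) ℝ) * Km with hK₂
  have hK₂_apply : ∀ u y, K₂ u y = Km u.2 y := fun u y => mapKernel_mul _ _ _ _
  have h₂Q : K₂ * Qm = P₂ * K₂ := by
    rw [hK₂, Matrix.mul_assoc, hmQ, ← Matrix.mul_assoc, ← Matrix.mul_assoc,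
      coupledMatrix_mul_mapKernel hpQ]
  have hK₂_nonneg : ∀ u y, 0 ≤ K₂ u y := fun u y => hK₂_apply u y ▸ (hrow hKm).1 _ _
  set P₃ := coupledMatrix P₂ Qm K₂ with hP₃
  have sP₃ : P₃ ∈ Matrix.rowStochastic ℝ _ :=
    coupledMatrix_mem_rowStochastic h₂Q sP₂ sQm hK₂_nonneg
  have := isProbabilityMeasure_jumpMeasure hr sP₃
  have hZ := isMarkovProcess_jumpProcess hr sP₃ ((0, 0), 0)
  have hΛ₃ : IsFibreKernel Prod.fst (graphKernel K₂) (((0, 0), 0) :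
      (Fin (N + 1) × Fin (N + 1)) × Fin (N + 1)) :=
    isFibreKernel_graphKernel (fun u => by simp only [hK₂_apply, (hrow hKm).2])
      fun y => by rw [hK₂_apply, hKm₀]
  have hΛ₂ : IsFibreKernel Prod.fst (graphKernel Kp) ((0, 0) : Fin (N + 1) × Fin (N + 1)) :=
    isFibreKernel_graphKernel (hrow hKp).2 hKp₀
  have i₃ := mul_smul_sub_one (graphKernel_mul_coupledMatrix h₂Q
    (Matrix.mem_rowStochastic_iff_sum.1 sP₂).1 hK₂_nonneg) r
  have i₂ := mul_smul_sub_one (graphKernel_mul_coupledMatrix hpQ (hrow sQp).1 (hrow hKp).1) r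
  have hY := hZ.map_of_intertwining hΛ₃ i₃
  refine ⟨_, _, jumpMeasure r P₃, this, fun t ω => (jumpProcess (t : ℝ) ω ((0, 0), 0)).2,
    fun t ω => (jumpProcess (t : ℝ) ω ((0, 0), 0)).1.2,
    fun t ω => (jumpProcess (t : ℝ) ω ((0, 0), 0)).1.1, ?_, ?_, ?_, fun t y => ?_, fun t y => ?_⟩
  · exact hZ.map_of_autonomous Prod.snd (G := Gm) (by
      rw [← smul_uniformization_sub_one Gm hr]
      exact (mul_smul_sub_one (coupledMatrix_mul_mapKernel h₂Q).symm r).symm)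
  · exact hY.map_of_autonomous Prod.snd (G := G) (by
      rw [← smul_uniformization_sub_one G hr]
      exact (mul_smul_sub_one (coupledMatrix_mul_mapKernel hpQ).symm r).symm)
  · exact hY.map_of_intertwining hΛ₂ (G := Gp) (by
      rw [← smul_uniformization_sub_one Gp hr]
      exact i₂)
  · have h := hY.condProb_of_intertwining hΛ₂ i₂ Prod.snd t y
    rwa [graphKernel_mul_mapKernel_snd] at h
  · have h := hZ.condProb_of_intertwining hΛ₃ i₃ Prod.snd t y
    rw [graphKernel_mul_mapKernel_snd] at h
    exact h.trans (Eventually.of_forall fun ω => hK₂_apply _ y)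

/-! ### Pathwise properties of the couplings -/

section TriangularKernel

lemma eq_zero_of_sum_eq_one {S : Type*} [Fintype S] [DecidableEq S] {K : Matrix S S ℝ}
    (hK : K ∈ Matrix.rowStochastic ℝ S) {x y : S} {A : Finset S} (hA : ∑ z ∈ A, K x z = 1)
    (hy : y ∉ A) : K x y = 0 := by
  obtain ⟨h0, h1⟩ := Matrix.mem_rowStochastic_iff_sum.1 hK
  have h2 := Finset.sum_le_sum_of_subset_of_nonneg (Finset.subset_univ (insert y A))
    fun z _ _ => h0 x z
  rw [Finset.sum_insert hy, hA, h1] at h2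
  linarith [h0 x y]

variable {N : ℕ} {K : Matrix (Fin (N + 1)) (Fin (N + 1)) ℝ}

lemma IsTriangularKernel.le_of_ne_zero (hK : IsTriangularKernel K) {x y : Fin (N + 1)}
    (h : K x y ≠ 0) : y ≤ x := by
  by_contra hxy
  exact h (eq_zero_of_sum_eq_one hK.stochastic (hK.triangular x) (by simpa using hxy))

lemma IsTriangularKernel.zero_row (hK : IsTriangularKernel K) (y : Fin (N + 1)) :
    K 0 y = if y = 0 then 1 else 0 := by
  have h1 := hK.triangular 0
  have h2 : Finset.Iic (0 : Fin (N + 1)) = {0} := by ext; simp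
  rw [h2, Finset.sum_singleton] at h1
  split_ifs with h
  · rw [h, h1]
  · by_contra h3
    exact h (Fin.le_zero_iff.1 (hK.le_of_ne_zero h3))

lemma IsTriangularKernel.eq_last_of_ne_zero (hK : IsTriangularKernel K) {y : Fin (N + 1)}
    (h : K (Fin.last N) y ≠ 0) : y = Fin.last N := by
  by_contra hy
  exact h (eq_zero_of_sum_eq_one hK.stochastic (A := {Fin.last N}) (by simp [hK.last])
    (by simpa using hy))

/-- Along pairs charged by a triangular kernel with `K(N, N) = 1` the state `N` is reached by both
coordinates simultaneously. -/
lemma IsTriangularKernel.eq_last_iff (hK : IsTriangularKernel K) {x y : Fin (N + 1)}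
    (h : K x y ≠ 0) : y = Fin.last N ↔ x = Fin.last N := by
  constructor
  · rintro rfl
    exact Fin.last_le_iff.1 (hK.le_of_ne_zero h)
  · rintro rfl
    exact hK.eq_last_of_ne_zero h

end TriangularKernel

section Paths

variable {Ω S T : Type*} [mΩ : MeasurableSpace Ω] {P : Measure Ω}

lemma ae_kernel_ne_zero [Fintype S] [MeasurableSpace S] [DiscreteMeasurableSpace S] [Fintype T]
    [MeasurableSpace T] [DiscreteMeasurableSpace T] [IsProbabilityMeasure P]
    {X : Ω → T} {Y : Ω → S} (hX : Measurable X) (K : S → T → ℝ)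
    {m : MeasurableSpace Ω} (hm : m ≤ mΩ) (hY : Measurable[m] Y)
    (h : ∀ y, P⟦{ω | X ω = y} | m⟧ =ᵐ[P] fun ω => K (Y ω) y) :
    ∀ᵐ ω ∂P, K (Y ω) (X ω) ≠ 0 := by
  have h1 : ∀ x y, K x y = 0 → ∀ᵐ ω ∂P, ¬ (Y ω = x ∧ X ω = y) := by
    intro x y hxy
    have h2 := measureReal_inter_of_condProb (mΩ := mΩ) (hX (measurableSet_singleton y))
      (hY.mono hm le_rfl) (g := fun x => K x y) hm (h y) (hY (measurableSet_singleton x))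
    rw [Finset.sum_eq_zero] at h2
    · exact (measure_eq_zero_iff_ae_notMem.1 ((measureReal_eq_zero_iff).1 h2))
    · intro x' _
      by_cases hx : x' = x
      · rw [hx, hxy, mul_zero]
      · rw [show Y ⁻¹' {x} ∩ {ω | Y ω = x'} = ∅ by
          ext ω
          simp only [Set.mem_inter_iff, Set.mem_preimage, Set.mem_singleton_iff,
            Set.mem_ofPred_eq, Set.mem_empty_iff_false, iff_false]
          rintro ⟨h3, h4⟩
          exact hx (h4.symm.trans h3), measureReal_empty, zero_mul]
  have h2 : ∀ᵐ ω ∂P, ∀ x y, K x y = 0 → ¬ (Y ω = x ∧ X ω = y) := by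
    simp only [ae_all_iff]
    exact h1
  filter_upwards [h2] with ω hω h3
  exact hω _ _ h3 ⟨rfl, rfl⟩

/-- A relation that holds almost surely at each time between two right-continuous processes holds
almost surely at all times. -/
lemma ae_forall_of_right_continuous {X : ℝ≥0 → Ω → S} {Y : ℝ≥0 → Ω → T}
    (hX : ∀ᵐ ω ∂P, ∀ t, ∀ᶠ s in 𝓝[≥] t, X s ω = X t ω)
    (hY : ∀ᵐ ω ∂P, ∀ t, ∀ᶠ s in 𝓝[≥] t, Y s ω = Y t ω) {R : S → T → Prop}
    (h : ∀ t, ∀ᵐ ω ∂P, R (X t ω) (Y t ω)) : ∀ᵐ ω ∂P, ∀ t, R (X t ω) (Y t ω) := by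
  obtain ⟨D, hD, hDd⟩ := TopologicalSpace.exists_countable_dense ℝ≥0
  have h1 : ∀ᵐ ω ∂P, ∀ t ∈ D, R (X t ω) (Y t ω) := (ae_ball_iff hD).2 fun t _ => h t
  filter_upwards [hX, hY, h1] with ω hXω hYω hω t
  obtain ⟨u, hu, hsub⟩ := mem_nhdsGE_iff_exists_Ico_subset.1 ((hXω t).and (hYω t))
  obtain ⟨s, hs, hts, hsu⟩ := hDd.exists_between hu
  obtain ⟨h2, h3⟩ := hsub ⟨hts.le, hsu⟩
  rw [← h2, ← h3]
  exact hω s hs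

lemma passageTime_congr {Ω : Type*} {N : ℕ} {X Y : ℝ≥0 → Ω → Fin (N + 1)} {ω : Ω}
    (h : ∀ t, X t ω = Fin.last N ↔ Y t ω = Fin.last N) : passageTime X ω = passageTime Y ω := by
  have h1 : ∀ t, X t ω ∈ ({Fin.last N} : Set _) ↔ Y t ω ∈ ({Fin.last N} : Set _) := h
  classical
  unfold passageTime hittingAfter
  exact if_congr (exists_congr fun t => and_congr_right' (h1 t)) (by simp only [h1]) rfl

end Paths

lemma IsIntertwinedCoupling.ae_kernel_ne_zero {Ω : Type*} [MeasurableSpace Ω] {P : Measure Ω}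
    [IsProbabilityMeasure P] {N : ℕ} {Gm G Gp Km Kp : Matrix (Fin (N + 1)) (Fin (N + 1)) ℝ}
    {Xm X Xp : ℝ≥0 → Ω → Fin (N + 1)} (h : IsIntertwinedCoupling P Gm G Gp Km Kp Xm X Xp) :
    ∀ᵐ ω ∂P, ∀ t, Kp (Xp t ω) (X t ω) ≠ 0 ∧ Km (X t ω) (Xm t ω) ≠ 0 := by
  have hp := ae_forall_of_right_continuous h.markov_plus.right_continuous
    h.markov.right_continuous (R := fun x y => Kp x y ≠ 0) fun t =>
      _root_.ae_kernel_ne_zero (h.markov.measurable t) Kp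
        (pastSigma_le h.markov_plus.measurable t) (measurable_pastSigma le_rfl) (h.cond_plus t)
  have hpair : ∀ t, Measurable fun ω => (Xp t ω, X t ω) := fun t =>
    (h.markov_plus.measurable t).prodMk (h.markov.measurable t)
  have hm := ae_forall_of_right_continuous h.markov.right_continuous
    h.markov_minus.right_continuous (R := fun x y => Km x y ≠ 0) fun t =>
      _root_.ae_kernel_ne_zero (h.markov_minus.measurable t) Km
        (pastSigma_le hpair t) (measurable_snd.comp (measurable_pastSigma
          (X := fun s ω => (Xp s ω, X s ω)) le_rfl)) (h.cond_minus t)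
  filter_upwards [hp, hm] with ω h1 h2 t using ⟨h1 t, h2 t⟩

lemma bdGenerator_nonneg {N : ℕ} {b d : ℕ → ℝ} (hb : ∀ x, 1 ≤ x → x ≤ N → 0 ≤ b x)
    (hd : ∀ x, 1 ≤ x → x ≤ N → 0 ≤ d x) (x y : Fin (N + 1)) (hxy : x ≠ y) :
    0 ≤ bdGenerator N b d x y := by
  simp only [bdGenerator, Matrix.of_apply]
  rw [if_neg hxy.symm]
  have hx := x.isLt
  have hy := y.isLt
  split_ifs with h1 h2
  · exact hb _ (by omega) (by omega)
  · exact hd _ (by omega) (by omega)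
  · exact le_rfl

theorem theorem1 (N : ℕ) (b d : ℕ → ℝ)
    (hb : ∀ x, 1 ≤ x → x ≤ N → 0 < b x)
    (hd : ∀ x, 1 ≤ x → x < N → 0 < d x)
    (hdN : d N = 0) :
    ∃ ev : ℕ → ℝ,
      ev 0 = 0 ∧ (∀ i, i < N → ev i < ev (i + 1)) ∧
      (∀ μ : ℝ, Module.End.HasEigenvalue (Matrix.toLin' (bdGenerator N b d)) μ ↔
        ∃ i, i ≤ N ∧ μ = -ev i) ∧
      ∃ Km Kp : Matrix (Fin (N + 1)) (Fin (N + 1)) ℝ,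
        IsTriangularKernel Km ∧ IsTriangularKernel Kp ∧
        Kp * bdGenerator N b d = bdGenerator N (fun x => ev (N + 1 - x)) 0 * Kp ∧
        bdGenerator N b d * Km = Km * bdGenerator N ev 0 ∧
        (∃ (Ω : Type) (_ : MeasurableSpace Ω) (P : Measure Ω) (_ : IsProbabilityMeasure P)
          (Xm X Xp : ℝ≥0 → Ω → Fin (N + 1)),
          IsIntertwinedCoupling P (bdGenerator N ev 0) (bdGenerator N b d)
            (bdGenerator N (fun x => ev (N + 1 - x)) 0) Km Kp Xm X Xp) ∧
        (∀ (Ω : Type*) (_ : MeasurableSpace Ω) (P : Measure Ω) (_ : IsProbabilityMeasure P)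
          (Xm X Xp : ℝ≥0 → Ω → Fin (N + 1)),
          IsIntertwinedCoupling P (bdGenerator N ev 0) (bdGenerator N b d)
            (bdGenerator N (fun x => ev (N + 1 - x)) 0) Km Kp Xm X Xp →
          (∀ᵐ ω ∂P, ∀ t, Xm t ω ≤ X t ω ∧ X t ω ≤ Xp t ω) ∧
          (∀ᵐ ω ∂P, passageTime Xm ω = passageTime X ω ∧
            passageTime X ω = passageTime Xp ω)) := by
  obtain ⟨ev, Km, Kp, hev0, hev, heig, hKm, hKp, hp, hm⟩ :=
    exists_eigenvalues_kernels N b d hb hd hdN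
  have hev_nonneg : ∀ i ≤ N, 0 ≤ ev i := by
    intro i hi
    induction i with
    | zero => exact hev0.ge
    | succ i ih => exact (ih (by omega)).trans (hev i (by omega)).le
  refine ⟨ev, hev0, hev, heig, Km, Kp, hKm, hKp, hp, hm, ?_, fun Ω _ P _ Xm X Xp h => ⟨?_, ?_⟩⟩
  · refine exists_isIntertwinedCoupling
      (bdGenerator_nonneg (fun x _ hx => hev_nonneg x hx) fun _ _ _ => le_rfl)
      (sum_row_bdGenerator _ _ _)
      (bdGenerator_nonneg (fun x h1 hx => (hb x h1 hx).le) fun x h1 hx => ?_)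
      (sum_row_bdGenerator _ _ _)
      (bdGenerator_nonneg (fun x h1 hx => hev_nonneg _ (by omega)) fun _ _ _ => le_rfl)
      (sum_row_bdGenerator _ _ _) hKm.stochastic hKp.stochastic hKm.zero_row hKp.zero_row hp hm
    rcases hx.eq_or_lt with rfl | hx
    · exact hdN.ge
    · exact (hd x h1 hx).le
  · filter_upwards [h.ae_kernel_ne_zero] with ω hω t
    exact ⟨hKm.le_of_ne_zero (hω t).2, hKp.le_of_ne_zero (hω t).1⟩
  · filter_upwards [h.ae_kernel_ne_zero] with ω hω
    exact ⟨passageTime_congr fun t => hKm.eq_last_iff (hω t).2,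
      passageTime_congr fun t => hKp.eq_last_iff (hω t).1⟩
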